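/- **Conventions.** A coarse space is a set $X$ with a family of *controlled* subsets of $X\times X$ that is closed under finite unions, subsets, transposition and composition, contains the diagonal, and covers $X\times X$. Maps $f,g\colon S\to X$ are *close* if $\{(f(s),g(s)) : s\in S\}$ is controlled; $B\subseteq X$ is *bounded* if $B\hookrightarrow X$ is close to a constant map (the empty set is always bounded). A map is *coarse* if it sends controlled sets to controlled sets and inverse images of bounded sets are bounded. Subsets and products carry the evident coarse structures. For $M \subseteq X\times X$ and $S\subseteq X$ put $M[S]=\{y : (x,y)\in M \text{ for some } x\in S\}$. The *coarse disjoint union* $\bigvee_i X_i$ is the disjoint union of the sets $X_i$, the controlled sets being the subsets of sets $\bigcup_i M_i\cup\bigcup_{i,j}B_i\times B_j$ with $M_i\subseteq X_i\times X_i$ controlled and $B_i\subseteq X_i$ bounded. A *generalised ray* $R$ is $[0,\infty)$ with a coarse structure in which every controlled set lies in an open controlled set, bounded sets have compact closure, and for controlled $M,N$ and $a\ge 0$ the sets $M+N$, $\{(u,v) : x\le u,v\le y \text{ for some } (x,y)\in M\}$ and $a+M=\{(a+x,a+y) : (x,y)\in M\}$ are controlled. An *elementary coarse homotopy* between coarse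 maps $f_0,f_1\colon X\to Y$ is a coarse map $H\colon \{(x,t)\in X\times R : t\le p(x)+1\}\to Y$, for some generalised ray $R$ and coarse map $p\colon X\to R$, with $f_0(x)=H(x,0)$ and $f_1(x)=H(x,p(x)+1)$. Coarse maps are *coarsely homotopic* if a chain of elementary coarse homotopies links them; *coarse homotopy equivalences* are defined accordingly. $X$ is *flasque* if there is a map $t\colon X\to X$, close to the identity, such that for each bounded $B$ one has $t^n[X]\cap B=\emptyset$ for all large $n$, and $\bigcup_{n}(t^n\times t^n)[M]$ is controlled for each controlled $M$. A decomposition $X=A\cup B$ is *coarsely excisive* if for each controlled $m$ there is a controlled $M$ with $m[A]\cap m[B]\subseteq M[A\cap B]$. Spectra are sequences of pointed spaces $E_n$ with pointed maps $E_n\to\Omega E_{n+1}$; a weak equivalence is a map inducing isomorphisms on all stable homotopy groups $\pi_k$, $k\in\mathbb Z$; a spectrum is weakly contractible if all its $\pi_k$ vanish; coproducts are levelwise wedges; a commutative square $B\leftarrow A\to C$, $B\to D\leftarrow C$ is a homotopy pushout if the map from the levelwise reduced double mapping cylinder of $B\leftarrow A\to C$ to $D$ is a weak equivalence. A functor $E$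 from coarse spaces and coarse maps to spectra is *coarsely excisive* if (1) $E(X)$ is weakly contractible for flasque $X$; (2) $E$ takes coarse homotopy equivalences to weak equivalences; (3) for each coarsely excisive decomposition $X=A\cup B$ the square of $E(A\cap B)$, $E(A)$, $E(B)$, $E(X)$ is a homotopy pushout; (4) for each family $(X_i)$ of coarse spaces the canonical map $\bigvee_i E(X_i)\to E(\bigvee_i X_i)$ is a weak equivalence. For a compact Hausdorff space $X$ let $\overline{\mathcal O}X=(X\times[0,1])/(X\times\{0\})$ (one point, the apex, if $X=\emptyset$), and let $\mathcal OX\subseteq\overline{\mathcal O}X$ be the *open cone*, the complement of $X\times\{1\}$, with the *continuously controlled* coarse structure: $M\subseteq\mathcal OX\times\mathcal OX$ is controlled if every $(a,b)$ in the closure of $M$ in $\overline{\mathcal O}X\times\overline{\mathcal O}X$ for which $a$ or $b$ lies in $X\times\{1\}$ satisfies $a=b$. A continuous $f\colon X\to Y$ induces the coarse map $[x,t]\mapsto[f(x),t]$. For $U\subseteq X$ let $\mathcal OU\subseteq\mathcal OX$ be the coarse subspace consisting of the apex and all points $[x,t]$ with $x\in U$. **Theorem.** Let $E$ be a coarsely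 excisive functor. Then $X\mapsto E(\mathcal OX)$ is an excisive functor on the category of compact Hausdorff spaces that are homotopy equivalent to CW-complexes. That is, it is a functor on this category, and 1. if a continuous map $f\colon X\to Y$ in this category is a homotopy equivalence, then $E(\mathcal OX)\to E(\mathcal OY)$ is a weak equivalence; 2. if $X$ is in this category and $X=U\cup V$ with $U,V\subseteq X$ open, then the square $$\begin{array}{ccc} E(\mathcal O(U\cap V)) & \to & E(\mathcal OU)\\ \downarrow & & \downarrow\\ E(\mathcal OV) & \to & E(\mathcal OX)\end{array}$$ is a homotopy pushout; 3. if $X=\coprod_{i} X_i$ is a disjoint union of topological spaces with $X$ and all $X_i$ in this category, then the canonical map $\bigvee_i E(\mathcal OX_i)\to E(\mathcal OX)$ is a weak equivalence. -/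

import Mathlib

open CategoryTheory Set Topology unitInterval
open scoped NNReal

universe u v w

/-! ### Spectra -/

/-- A (sequential) spectrum: pointed topological spaces `X₀, X₁, …` with pointed continuous maps
`Xₙ → Ω Xₙ₊₁`, the adjoints of the structure maps `Σ Xₙ → Xₙ₊₁`. -/
structure TopSpectrum : Type (v + 1) where
  space : ℕ → Type v
  [top : ∀ n, TopologicalSpace (space n)]
  pt : ∀ n, space n
  adj : ∀ n, C(space n, C(I, space (n + 1)))
  adj_zero : ∀ n x, adj n x 0 = pt (n + 1)
  adj_one : ∀ n x, adj n x 1 = pt (n + 1)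
  adj_pt : ∀ n s, adj n (pt n) s = pt (n + 1)

attribute [instance] TopSpectrum.top

namespace TopSpectrum

/-- A map of spectra: pointed continuous maps that commute strictly with the structure maps. -/
@[ext]
structure Hom (A : TopSpectrum.{v}) (B : TopSpectrum.{w}) where
  app : ∀ n, C(A.space n, B.space n)
  app_pt : ∀ n, app n (A.pt n) = B.pt n
  app_adj : ∀ n x s, app (n + 1) (A.adj n x s) = B.adj n (app n x) s

instance : Category TopSpectrum.{v} where
  Hom A B := Hom A B
  id A := ⟨fun _ => ContinuousMap.id _, fun _ => rfl, fun _ _ _ => rfl⟩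
  comp f g := ⟨fun n => (g.app n).comp (f.app n),
    fun n => by simp [f.app_pt, g.app_pt], fun n x s => by simp [f.app_adj, g.app_adj]⟩

/-- The stabilization `π_m (Xₙ) → π_{m+1} (Xₙ₊₁)` on representatives. -/
def stab (A : TopSpectrum.{v}) {n m : ℕ} (γ : GenLoop (Fin m) (A.space n) (A.pt n)) :
    GenLoop (Fin (m + 1)) (A.space (n + 1)) (A.pt (n + 1)) :=
  ⟨⟨fun y => A.adj n (γ.1 (Fin.tail y)) (y 0), by
      have h : Continuous fun y : Fin (m + 1) → I => (Fin.tail y : Fin m → I) :=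
        continuous_pi fun i => continuous_apply _
      fun_prop⟩, by
    rintro y ⟨i, hi⟩
    refine Fin.cases (fun hi => ?_) (fun j hj => ?_) i hi
    · rcases hi with hi | hi
      · simp [hi, A.adj_zero]
      · simp [hi, A.adj_one]
    · have h : γ.1 (Fin.tail y) = A.pt n := γ.2 (Fin.tail y) ⟨j, hj⟩
      change A.adj n (γ.1 (Fin.tail y)) (y 0) = _
      rw [h, A.adj_pt]⟩

/-- Representatives of elements of the stable homotopy group `π_k`, `k ∈ ℤ`: based maps
`(I^m, ∂I^m) → (Xₙ, *)` with `m = n + k`. -/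
structure StableRep (A : TopSpectrum.{v}) (k : ℤ) where
  n : ℕ
  m : ℕ
  index : (m : ℤ) = n + k
  loop : GenLoop (Fin m) (A.space n) (A.pt n)

/-- The relation that generates the colimit `π_k A = colimₙ π_{n+k} (Xₙ)`. -/
inductive StableRel (A : TopSpectrum.{v}) (k : ℤ) : StableRep A k → StableRep A k → Prop
  | homotopy (n m : ℕ) (h : (m : ℤ) = n + k) (γ γ' : GenLoop (Fin m) (A.space n) (A.pt n)) :
      GenLoop.Homotopic γ γ' → StableRel A k ⟨n, m, h, γ⟩ ⟨n, m, h, γ'⟩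
  | stab (n m : ℕ) (h : (m : ℤ) = n + k) (γ : GenLoop (Fin m) (A.space n) (A.pt n)) :
      StableRel A k ⟨n, m, h, γ⟩ ⟨n + 1, m + 1, by push_cast; omega, A.stab γ⟩

/-- The underlying set of the stable homotopy group `π_k A`. -/
def StablePi (A : TopSpectrum.{v}) (k : ℤ) : Type v := Quot (StableRel A k)

/-- The map of representatives induced by a map of spectra. -/
def Hom.mapRep {A : TopSpectrum.{v}} {B : TopSpectrum.{w}} (f : Hom A B) (k : ℤ)
    (r : StableRep A k) : StableRep B k :=
  ⟨r.n, r.m, r.index, ⟨(f.app r.n).comp r.loop.1, fun y hy => by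
    have h : r.loop.1 y = A.pt r.n := r.loop.2 y hy
    simp [h, f.app_pt]⟩⟩

/-- The map `π_k A → π_k B` induced by a map of spectra. -/
def Hom.mapPi {A : TopSpectrum.{v}} {B : TopSpectrum.{w}} (f : Hom A B) (k : ℤ) :
    StablePi A k → StablePi B k :=
  Quot.map (f.mapRep k) (by
    rintro _ _ (⟨n, m, h, γ, γ', H⟩ | ⟨n, m, h, γ⟩)
    · exact StableRel.homotopy n m h _ _ (H.map fun F => F.compContinuousMap (f.app n))
    · have e : f.mapRep k ⟨n + 1, m + 1, by push_cast; omega, A.stab γ⟩ =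
          ⟨n + 1, m + 1, by push_cast; omega, B.stab (f.mapRep k ⟨n, m, h, γ⟩).loop⟩ := by
        unfold Hom.mapRep
        congr 1
        apply Subtype.ext
        ext y
        exact f.app_adj n _ _
      rw [e]
      exact StableRel.stab n m h _)

/-- A weak homotopy equivalence of spectra: an isomorphism on all stable homotopy groups. -/
def Hom.IsWeakEquiv {A : TopSpectrum.{v}} {B : TopSpectrum.{w}} (f : Hom A B) : Prop :=
  ∀ k : ℤ, Function.Bijective (f.mapPi k)

/-- A spectrum is weakly contractible if all its stable homotopy groups vanish. -/
def WeaklyContractible (A : TopSpectrum.{v}) : Prop := ∀ k : ℤ, Subsingleton (StablePi A k)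

section Wedge

variable {ι : Type u} (A : ι → TopSpectrum.{v})

/-- The relation that identifies all base points with one extra point. -/
inductive WedgeRel (n : ℕ) :
    PUnit.{u + 1} ⊕ (Σ i, (A i).space n) → PUnit.{u + 1} ⊕ (Σ i, (A i).space n) → Prop
  | base (i : ι) : WedgeRel n (Sum.inr ⟨i, (A i).pt n⟩) (Sum.inl PUnit.unit)

/-- The inclusion of a summand in the wedge of the `n`-th spaces. -/
def wedgeIn (n : ℕ) (i : ι) : C((A i).space n, Quot (WedgeRel A n)) :=
  ⟨fun x => Quot.mk _ (Sum.inr ⟨i, x⟩),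
    continuous_quot_mk.comp (continuous_inr.comp continuous_sigmaMk)⟩

/-- The coproduct in the category of spectra: the levelwise wedge of pointed spaces. -/
def wedge : TopSpectrum.{max u v} where
  space n := Quot (WedgeRel A n)
  pt n := Quot.mk _ (Sum.inl PUnit.unit)
  adj n :=
    { toFun := Quot.lift
        (Sum.elim (fun _ => ContinuousMap.const I (Quot.mk _ (Sum.inl PUnit.unit)))
          (fun p => (wedgeIn A (n + 1) p.1).comp ((A p.1).adj n p.2))) (by
            rintro _ _ ⟨i⟩
            ext s
            simp only [Sum.elim_inr, Sum.elim_inl, ContinuousMap.comp_apply, (A i).adj_pt,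
              ContinuousMap.const_apply]
            exact Quot.sound (WedgeRel.base i))
      continuous_toFun := continuous_quot_lift _ (by
        refine continuous_sum_dom.2 ⟨continuous_const, continuous_sigma fun i => ?_⟩
        exact (ContinuousMap.continuous_postcomp (wedgeIn A (n + 1) i)).comp
          ((A i).adj n).continuous) }
  adj_zero n x := by
    induction x using Quot.ind with | mk a => ?_
    rcases a with _ | ⟨i, x⟩
    · rfl
    · change wedgeIn A (n + 1) i ((A i).adj n x 0) = _
      rw [(A i).adj_zero]
      exact Quot.sound (WedgeRel.base i)
  adj_one n x := by
    induction x using Quot.ind with | mk a => ?_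
    rcases a with _ | ⟨i, x⟩
    · rfl
    · change wedgeIn A (n + 1) i ((A i).adj n x 1) = _
      rw [(A i).adj_one]
      exact Quot.sound (WedgeRel.base i)
  adj_pt n s := rfl

/-- The map out of the wedge with given components. -/
def wedgeDesc {A : ι → TopSpectrum.{v}} {B : TopSpectrum.{w}} (f : ∀ i, Hom (A i) B) :
    Hom (wedge A) B where
  app n :=
    { toFun := Quot.lift (Sum.elim (fun _ => B.pt n) (fun p => (f p.1).app n p.2)) (by
        rintro _ _ ⟨i⟩
        exact (f i).app_pt n)
      continuous_toFun := continuous_quot_lift _ (by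
        refine continuous_sum_dom.2 ⟨continuous_const, continuous_sigma fun i => ?_⟩
        exact ((f i).app n).continuous) }
  app_pt n := rfl
  app_adj n x s := by
    induction x using Quot.ind with | mk a => ?_
    rcases a with _ | ⟨i, x⟩
    · exact (B.adj_pt n s).symm
    · exact (f i).app_adj n x s

end Wedge

section HomotopyPushout

variable {A B C D : TopSpectrum.{v}}

/-- The identifications in the reduced double mapping cylinder of `Bₙ ← Aₙ → Cₙ`. -/
inductive CylRel (f : A ⟶ B) (g : A ⟶ C) (n : ℕ) :
    (B.space n ⊕ C.space n) ⊕ (A.space n × I) →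
    (B.space n ⊕ C.space n) ⊕ (A.space n × I) → Prop
  | left (a : A.space n) : CylRel f g n (Sum.inr (a, 0)) (Sum.inl (Sum.inl (f.app n a)))
  | right (a : A.space n) : CylRel f g n (Sum.inr (a, 1)) (Sum.inl (Sum.inr (g.app n a)))
  | base (t : I) : CylRel f g n (Sum.inr (A.pt n, t)) (Sum.inl (Sum.inl (B.pt n)))

/-- The adjoint structure map of the double mapping cylinder before passing to the quotient. -/
def cylAdj (f : A ⟶ B) (g : A ⟶ C) (n : ℕ) :
    C((B.space n ⊕ C.space n) ⊕ (A.space n × I), C(I, Quot (CylRel f g (n + 1)))) where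
  toFun := Sum.elim
    (Sum.elim
      (fun b => (⟨fun x => Quot.mk _ (Sum.inl (Sum.inl x)), by fun_prop⟩ :
        C(B.space (n + 1), Quot (CylRel f g (n + 1)))).comp (B.adj n b))
      (fun c => (⟨fun x => Quot.mk _ (Sum.inl (Sum.inr x)), by fun_prop⟩ :
        C(C.space (n + 1), Quot (CylRel f g (n + 1)))).comp (C.adj n c)))
    (fun p => (⟨fun q : (A.space n × I) × I => Quot.mk _ (Sum.inr (A.adj n q.1.1 q.2, q.1.2)),
        by fun_prop⟩ : C((A.space n × I) × I, Quot (CylRel f g (n + 1)))).curry p)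
  continuous_toFun := by
    refine continuous_sum_dom.2 ⟨continuous_sum_dom.2 ⟨?_, ?_⟩, ContinuousMap.continuous _⟩
    · exact (ContinuousMap.continuous_postcomp _).comp (B.adj n).continuous
    · exact (ContinuousMap.continuous_postcomp _).comp (C.adj n).continuous

theorem cyl_base (f : A ⟶ B) (g : A ⟶ C) (n : ℕ) :
    Quot.mk (CylRel f g n) (Sum.inl (Sum.inr (C.pt n))) =
      Quot.mk (CylRel f g n) (Sum.inl (Sum.inl (B.pt n))) := by
  rw [← g.app_pt n, ← Quot.sound (CylRel.right (f := f) (g := g) (A.pt n))]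
  exact Quot.sound (CylRel.base 1)

/-- The homotopy pushout of `B ← A → C`: the levelwise reduced double mapping cylinder. -/
def cyl (f : A ⟶ B) (g : A ⟶ C) : TopSpectrum.{v} where
  space n := Quot (CylRel f g n)
  pt n := Quot.mk _ (Sum.inl (Sum.inl (B.pt n)))
  adj n :=
    { toFun := Quot.lift (cylAdj f g n) (by
        rintro _ _ (a | a | t)
        · ext s
          refine (Quot.sound (CylRel.left (f := f) (g := g) (A.adj n a s))).trans ?_
          rw [f.app_adj n a s]; rfl
        · ext s
          refine (Quot.sound (CylRel.right (f := f) (g := g) (A.adj n a s))).trans ?_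
          rw [g.app_adj n a s]; rfl
        · ext s
          change Quot.mk (CylRel f g (n + 1)) (Sum.inr (A.adj n (A.pt n) s, t)) =
            Quot.mk (CylRel f g (n + 1)) (Sum.inl (Sum.inl (B.adj n (B.pt n) s)))
          rw [A.adj_pt, B.adj_pt]
          exact Quot.sound (CylRel.base t))
      continuous_toFun := continuous_quot_lift _ (cylAdj f g n).continuous }
  adj_zero n x := by
    induction x using Quot.ind with | mk p => ?_
    rcases p with (b | c) | ⟨a, t⟩
    · change Quot.mk (CylRel f g (n + 1)) (Sum.inl (Sum.inl (B.adj n b 0))) = _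
      rw [B.adj_zero]
    · change Quot.mk (CylRel f g (n + 1)) (Sum.inl (Sum.inr (C.adj n c 0))) = _
      rw [C.adj_zero]; exact cyl_base f g _
    · change Quot.mk (CylRel f g (n + 1)) (Sum.inr (A.adj n a 0, t)) = _
      rw [A.adj_zero]; exact Quot.sound (CylRel.base t)
  adj_one n x := by
    induction x using Quot.ind with | mk p => ?_
    rcases p with (b | c) | ⟨a, t⟩
    · change Quot.mk (CylRel f g (n + 1)) (Sum.inl (Sum.inl (B.adj n b 1))) = _
      rw [B.adj_one]
    · change Quot.mk (CylRel f g (n + 1)) (Sum.inl (Sum.inr (C.adj n c 1))) = _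
      rw [C.adj_one]; exact cyl_base f g _
    · change Quot.mk (CylRel f g (n + 1)) (Sum.inr (A.adj n a 1, t)) = _
      rw [A.adj_one]; exact Quot.sound (CylRel.base t)
  adj_pt n s := by
    change Quot.mk (CylRel f g (n + 1)) (Sum.inl (Sum.inl (B.adj n (B.pt n) s))) = _
    rw [B.adj_pt]

/-- The canonical map from the double mapping cylinder of `B ← A → C` to the fourth corner of a
commutative square. -/
def cylDesc (f : A ⟶ B) (g : A ⟶ C) (h : B ⟶ D) (k : C ⟶ D) (e : f ≫ h = g ≫ k) :
    cyl f g ⟶ D where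
  app n :=
    { toFun := Quot.lift
        (Sum.elim (Sum.elim (h.app n) (k.app n)) (fun p => h.app n (f.app n p.1))) (by
          rintro _ _ (a | a | t)
          · rfl
          · exact congrArg (fun φ : A ⟶ D => φ.app n a) e
          · exact congrArg (h.app n) (f.app_pt n))
      continuous_toFun := continuous_quot_lift _ (by
        refine continuous_sum_dom.2 ⟨continuous_sum_dom.2 ⟨?_, ?_⟩, ?_⟩
        · exact (h.app n).continuous
        · exact (k.app n).continuous
        · exact (h.app n).continuous.comp ((f.app n).continuous.comp continuous_fst)) }
  app_pt n := h.app_pt n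
  app_adj n x s := by
    induction x using Quot.ind with | mk p => ?_
    rcases p with (b | c) | ⟨a, t⟩
    · exact h.app_adj n b s
    · exact k.app_adj n c s
    · exact (congrArg (h.app (n + 1)) (f.app_adj n a s)).trans (h.app_adj n _ s)

/-- A commutative square of spectra is a homotopy push-out diagram if the map from the double
mapping cylinder to the fourth corner is a weak homotopy equivalence. -/
def IsHomotopyPushout (f : A ⟶ B) (g : A ⟶ C) (h : B ⟶ D) (k : C ⟶ D) : Prop :=
  ∃ e : f ≫ h = g ≫ k, Hom.IsWeakEquiv (cylDesc f g h k e)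

end HomotopyPushout

end TopSpectrum

/-! ### Coarse spaces -/

/-- The composite `M₁ M₂` of two relations. -/
def relComp {X : Type u} (M N : Set (X × X)) : Set (X × X) :=
  {p | ∃ y, (p.1, y) ∈ M ∧ (y, p.2) ∈ N}

/-- The set `M[S]`. -/
def relImage {X : Type u} (M : Set (X × X)) (S : Set X) : Set X := {y | ∃ x ∈ S, (x, y) ∈ M}

/-- A (unital) coarse structure on a set. -/
structure CoarseStructure (X : Type u) where
  Controlled : Set (X × X) → Prop
  union : ∀ {M N}, Controlled M → Controlled N → Controlled (M ∪ N)
  subset : ∀ {M N}, Controlled N → M ⊆ N → Controlled M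
  symm : ∀ {M}, Controlled M → Controlled (Prod.swap ⁻¹' M)
  comp : ∀ {M N}, Controlled M → Controlled N → Controlled (relComp M N)
  diag : Controlled {p | p.1 = p.2}
  connected : ∀ x y, ∃ M, Controlled M ∧ (x, y) ∈ M

namespace CoarseStructure

/-- Bounded subsets: those whose inclusion is close to a constant map. (The empty subset is
bounded also in the empty space, where there are no points to be the constant value.) -/
def Bounded {X : Type u} (s : CoarseStructure X) (B : Set X) : Prop :=
  B = ∅ ∨ ∃ x, s.Controlled (B ×ˢ {x})

theorem Bounded.mono {X : Type u} {s : CoarseStructure X} {B B' : Set X} (h : s.Bounded B)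
    (hB : B' ⊆ B) : s.Bounded B' := by
  rcases h with rfl | ⟨x, hx⟩
  · exact Or.inl (subset_empty_iff.1 hB)
  · exact Or.inr ⟨x, s.subset hx (prod_mono hB le_rfl)⟩

theorem Bounded.prod {X : Type u} {s : CoarseStructure X} {B B' : Set X} (h : s.Bounded B)
    (h' : s.Bounded B') : s.Controlled (B ×ˢ B') := by
  rcases h with rfl | ⟨x, hx⟩
  · exact s.subset s.diag (by simp)
  rcases h' with rfl | ⟨y, hy⟩
  · exact s.subset s.diag (by simp)
  obtain ⟨M, hM, hxy⟩ := s.connected x y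
  refine s.subset (s.comp (s.comp hx hM) (s.symm hy)) ?_
  rintro ⟨b, b'⟩ ⟨hb, hb'⟩
  exact ⟨y, ⟨x, ⟨hb, rfl⟩, hxy⟩, ⟨hb', rfl⟩⟩

theorem bounded_of_prod {X : Type u} {s : CoarseStructure X} {B : Set X}
    (h : s.Controlled (B ×ˢ B)) : s.Bounded B := by
  rcases B.eq_empty_or_nonempty with rfl | ⟨b, hb⟩
  · exact Or.inl rfl
  · exact Or.inr ⟨b, s.subset h (prod_mono le_rfl (by simpa using hb))⟩

/-- Two maps into a coarse space are close. -/
def Close {S : Type w} {X : Type u} (s : CoarseStructure X) (f g : S → X) : Prop :=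
  s.Controlled (range fun a => (f a, g a))

/-- A coarse structure is compatible with a topology on the same (Hausdorff) space. -/
def CompatibleWithTopology {X : Type u} [TopologicalSpace X] (s : CoarseStructure X) : Prop :=
  (∀ M, s.Controlled M → ∃ W, s.Controlled W ∧ IsOpen W ∧ M ⊆ W) ∧
    ∀ B, s.Bounded B → IsCompact (closure B)

/-- The product coarse structure. -/
def prod {X : Type u} {Y : Type v} (s : CoarseStructure X) (t : CoarseStructure Y) :
    CoarseStructure (X × Y) where
  Controlled M := ∃ M₁ M₂, s.Controlled M₁ ∧ t.Controlled M₂ ∧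
    ∀ p ∈ M, (p.1.1, p.2.1) ∈ M₁ ∧ (p.1.2, p.2.2) ∈ M₂
  union := by
    rintro M N ⟨M₁, M₂, h₁, h₂, h⟩ ⟨N₁, N₂, k₁, k₂, k⟩
    refine ⟨M₁ ∪ N₁, M₂ ∪ N₂, s.union h₁ k₁, t.union h₂ k₂, ?_⟩
    rintro p (hp | hp)
    · exact ⟨Or.inl (h p hp).1, Or.inl (h p hp).2⟩
    · exact ⟨Or.inr (k p hp).1, Or.inr (k p hp).2⟩
  subset := by
    rintro M N ⟨N₁, N₂, k₁, k₂, k⟩ hMN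
    exact ⟨N₁, N₂, k₁, k₂, fun p hp => k p (hMN hp)⟩
  symm := by
    rintro M ⟨M₁, M₂, h₁, h₂, h⟩
    exact ⟨_, _, s.symm h₁, t.symm h₂, fun p hp => h _ hp⟩
  comp := by
    rintro M N ⟨M₁, M₂, h₁, h₂, h⟩ ⟨N₁, N₂, k₁, k₂, k⟩
    refine ⟨_, _, s.comp h₁ k₁, t.comp h₂ k₂, ?_⟩
    rintro p ⟨y, hy, hy'⟩
    exact ⟨⟨y.1, (h _ hy).1, (k _ hy').1⟩, ⟨y.2, (h _ hy).2, (k _ hy').2⟩⟩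
  diag := ⟨_, _, s.diag, t.diag, fun p hp => ⟨congrArg Prod.fst hp, congrArg Prod.snd hp⟩⟩
  connected := by
    intro x y
    obtain ⟨M, hM, h⟩ := s.connected x.1 y.1
    obtain ⟨N, hN, k⟩ := t.connected x.2 y.2
    refine ⟨{(x, y)}, ⟨M, N, hM, hN, ?_⟩, rfl⟩
    rintro p rfl
    exact ⟨h, k⟩

/-- The subspace coarse structure. -/
def sub {X : Type u} (s : CoarseStructure X) (A : Set X) : CoarseStructure A where
  Controlled M := s.Controlled (Prod.map Subtype.val Subtype.val '' M)
  union h k := by rw [image_union]; exact s.union h k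
  subset h k := s.subset h (image_mono k)
  symm {M} h := by
    refine s.subset (s.symm h) ?_
    rintro _ ⟨p, hp, rfl⟩
    exact ⟨p.swap, hp, rfl⟩
  comp {M N} h k := by
    refine s.subset (s.comp h k) ?_
    rintro _ ⟨p, ⟨y, hy, hy'⟩, rfl⟩
    exact ⟨y, ⟨_, hy, rfl⟩, ⟨_, hy', rfl⟩⟩
  diag := by
    refine s.subset s.diag ?_
    rintro _ ⟨p, hp, rfl⟩
    exact congrArg Subtype.val hp
  connected x y := by
    obtain ⟨M, hM, h⟩ := s.connected x y
    refine ⟨{(x, y)}, s.subset hM ?_, rfl⟩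
    rintro _ ⟨_, rfl, rfl⟩
    exact h

/-- The coarse disjoint union `⋁ X_i`. -/
def disjUnion {ι : Type u} {X : ι → Type v} (s : ∀ i, CoarseStructure (X i)) :
    CoarseStructure (Σ i, X i) where
  Controlled M := ∃ (N : ∀ i, Set (X i × X i)) (B : ∀ i, Set (X i)),
    (∀ i, (s i).Controlled (N i)) ∧ (∀ i, (s i).Bounded (B i)) ∧
      M ⊆ (⋃ i, Prod.map (Sigma.mk i) (Sigma.mk i) '' N i) ∪
        ⋃ i, ⋃ j, (Sigma.mk i '' B i) ×ˢ (Sigma.mk j '' B j)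
  union := by
    rintro M M' ⟨N, B, hN, hB, h⟩ ⟨N', B', hN', hB', h'⟩
    refine ⟨fun i => N i ∪ N' i ∪ (B i ×ˢ B i ∪ B' i ×ˢ B' i), fun i => B i ∪ B' i,
      fun i => (s i).union ((s i).union (hN i) (hN' i))
        ((s i).union ((hB i).prod (hB i)) ((hB' i).prod (hB' i))), fun i => ?_, ?_⟩
    · apply bounded_of_prod
      refine (s i).subset ((s i).union
        ((s i).union ((hB i).prod (hB i)) ((hB i).prod (hB' i)))
        ((s i).union ((hB' i).prod (hB i)) ((hB' i).prod (hB' i)))) ?_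
      rintro ⟨x, y⟩ ⟨hx | hx, hy | hy⟩
      · exact Or.inl (Or.inl ⟨hx, hy⟩)
      · exact Or.inl (Or.inr ⟨hx, hy⟩)
      · exact Or.inr (Or.inl ⟨hx, hy⟩)
      · exact Or.inr (Or.inr ⟨hx, hy⟩)
    · rintro p (hp | hp)
      · rcases h hp with hp | hp
        · obtain ⟨i, q, hq, rfl⟩ := mem_iUnion.1 hp
          exact Or.inl (mem_iUnion.2 ⟨i, q, Or.inl (Or.inl hq), rfl⟩)
        · obtain ⟨i, hp⟩ := mem_iUnion.1 hp
          obtain ⟨j, ⟨a, ha, ha'⟩, ⟨b, hb, hb'⟩⟩ := mem_iUnion.1 hp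
          exact Or.inr (mem_iUnion.2 ⟨i, mem_iUnion.2
            ⟨j, ⟨a, Or.inl ha, ha'⟩, ⟨b, Or.inl hb, hb'⟩⟩⟩)
      · rcases h' hp with hp | hp
        · obtain ⟨i, q, hq, rfl⟩ := mem_iUnion.1 hp
          exact Or.inl (mem_iUnion.2 ⟨i, q, Or.inl (Or.inr hq), rfl⟩)
        · obtain ⟨i, hp⟩ := mem_iUnion.1 hp
          obtain ⟨j, ⟨a, ha, ha'⟩, ⟨b, hb, hb'⟩⟩ := mem_iUnion.1 hp
          exact Or.inr (mem_iUnion.2 ⟨i, mem_iUnion.2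
            ⟨j, ⟨a, Or.inr ha, ha'⟩, ⟨b, Or.inr hb, hb'⟩⟩⟩)
  subset := by
    rintro M M' ⟨N, B, hN, hB, h⟩ hM
    exact ⟨N, B, hN, hB, hM.trans h⟩
  symm := by
    rintro M ⟨N, B, hN, hB, h⟩
    refine ⟨fun i => Prod.swap ⁻¹' N i, B, fun i => (s i).symm (hN i), hB, ?_⟩
    rintro p hp
    rcases h hp with hp | hp
    · obtain ⟨i, q, hq, hqp⟩ := mem_iUnion.1 hp
      refine Or.inl (mem_iUnion.2 ⟨i, q.swap, hq, ?_⟩)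
      exact congrArg Prod.swap hqp
    · obtain ⟨i, hp⟩ := mem_iUnion.1 hp
      obtain ⟨j, ha, hb⟩ := mem_iUnion.1 hp
      exact Or.inr (mem_iUnion.2 ⟨j, mem_iUnion.2 ⟨i, hb, ha⟩⟩)
  comp := by
    rintro M M' ⟨N, B, hN, hB, h⟩ ⟨N', B', hN', hB', h'⟩
    have enl : ∀ i, ∀ P : Set (X i × X i), (s i).Controlled P → ∀ S, (s i).Bounded S →
        (s i).Bounded (relImage P S) := by
      rintro i P hP S (rfl | ⟨x, hx⟩)
      · left; ext; simp [relImage]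
      · refine Or.inr ⟨x, (s i).subset ((s i).comp ((s i).symm hP) hx) ?_⟩
        rintro ⟨y, z⟩ ⟨⟨a, ha, hay⟩, hz⟩
        exact ⟨a, hay, ha, hz⟩
    let T : ∀ i, Set (X i) := fun i =>
      (B i ∪ B' i) ∪ (relImage (Prod.swap ⁻¹' N i) (B' i) ∪ relImage (N' i) (B i))
    have uni : ∀ i, ∀ S S' : Set (X i), (s i).Bounded S → (s i).Bounded S' →
        (s i).Bounded (S ∪ S') := by
      intro i S S' hS hS'
      apply bounded_of_prod
      refine (s i).subset ((s i).union
        ((s i).union (hS.prod hS) (hS.prod hS'))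
        ((s i).union (hS'.prod hS) (hS'.prod hS'))) ?_
      rintro ⟨x, y⟩ ⟨hx | hx, hy | hy⟩
      · exact Or.inl (Or.inl ⟨hx, hy⟩)
      · exact Or.inl (Or.inr ⟨hx, hy⟩)
      · exact Or.inr (Or.inl ⟨hx, hy⟩)
      · exact Or.inr (Or.inr ⟨hx, hy⟩)
    refine ⟨fun i => relComp (N i) (N' i), T, fun i => (s i).comp (hN i) (hN' i), fun i =>
      uni i _ _ (uni i _ _ (hB i) (hB' i))
        (uni i _ _ (enl i _ ((s i).symm (hN i)) _ (hB' i)) (enl i _ (hN' i) _ (hB i))), ?_⟩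
    rintro ⟨x, z⟩ ⟨y, hxy, hyz⟩
    rcases h hxy with h1 | h1 <;> rcases h' hyz with h2 | h2
    · obtain ⟨i, ⟨a, b⟩, hq, e⟩ := mem_iUnion.1 h1
      obtain ⟨j, ⟨c, d⟩, hr, e'⟩ := mem_iUnion.1 h2
      simp only [Prod.map_apply, Prod.mk.injEq] at e e'
      obtain ⟨rfl, rfl⟩ := e
      obtain ⟨e1, rfl⟩ := e'
      obtain ⟨rfl, e1⟩ := Sigma.mk.inj_iff.1 e1
      obtain rfl := eq_of_heq e1
      exact Or.inl (mem_iUnion.2 ⟨_, (a, d), ⟨_, hq, hr⟩, rfl⟩)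
    · obtain ⟨i, ⟨a, b⟩, hq, e⟩ := mem_iUnion.1 h1
      obtain ⟨j, h2⟩ := mem_iUnion.1 h2
      obtain ⟨k, ⟨c, hc, e1⟩, ⟨d, hd, e2⟩⟩ := mem_iUnion.1 h2
      simp only [Prod.map_apply, Prod.mk.injEq] at e e1 e2
      obtain ⟨rfl, rfl⟩ := e
      obtain ⟨rfl, e1⟩ := Sigma.mk.inj_iff.1 e1
      obtain rfl := eq_of_heq e1
      exact Or.inr (mem_iUnion.2 ⟨_, mem_iUnion.2 ⟨k,
        ⟨a, Or.inr (Or.inl ⟨_, hc, hq⟩), rfl⟩, ⟨d, Or.inl (Or.inr hd), e2⟩⟩⟩)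
    · obtain ⟨i, h1⟩ := mem_iUnion.1 h1
      obtain ⟨j, ⟨a, ha, e1⟩, ⟨b, hb, e2⟩⟩ := mem_iUnion.1 h1
      obtain ⟨k, ⟨c, d⟩, hr, e'⟩ := mem_iUnion.1 h2
      simp only [Prod.map_apply, Prod.mk.injEq] at e' e1 e2
      obtain ⟨e3, rfl⟩ := e'
      rw [← e2] at e3
      obtain ⟨rfl, e3⟩ := Sigma.mk.inj_iff.1 e3
      obtain rfl := eq_of_heq e3
      exact Or.inr (mem_iUnion.2 ⟨i, mem_iUnion.2 ⟨_,
        ⟨a, Or.inl (Or.inl ha), e1⟩, ⟨d, Or.inr (Or.inr ⟨_, hb, hr⟩), rfl⟩⟩⟩)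
    · obtain ⟨i, h1⟩ := mem_iUnion.1 h1
      obtain ⟨j, ⟨a, ha, e1⟩, -⟩ := mem_iUnion.1 h1
      obtain ⟨k, h2⟩ := mem_iUnion.1 h2
      obtain ⟨l, -, ⟨d, hd, e2⟩⟩ := mem_iUnion.1 h2
      exact Or.inr (mem_iUnion.2 ⟨i, mem_iUnion.2 ⟨l,
        ⟨a, Or.inl (Or.inl ha), e1⟩, ⟨d, Or.inl (Or.inr hd), e2⟩⟩⟩)
  diag := by
    refine ⟨fun i => {p | p.1 = p.2}, fun i => ∅, fun i => (s i).diag, fun i => Or.inl rfl, ?_⟩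
    rintro ⟨⟨i, x⟩, y⟩ h
    obtain rfl : (⟨i, x⟩ : Σ i, X i) = y := h
    exact Or.inl (mem_iUnion.2 ⟨i, (x, x), rfl, rfl⟩)
  connected := by
    classical
    rintro x y
    refine ⟨{(x, y)}, ⟨fun i => {p | p.1 = p.2},
      fun i => Sigma.mk i ⁻¹' {x} ∪ Sigma.mk i ⁻¹' {y}, fun i => (s i).diag, fun i => ?_, ?_⟩, rfl⟩
    · have sing : ∀ z : Σ i, X i, (s i).Bounded (Sigma.mk i ⁻¹' {z}) := by
        rintro ⟨j, a⟩
        rcases (Sigma.mk i ⁻¹' {(⟨j, a⟩ : Σ i, X i)}).eq_empty_or_nonempty with h | ⟨b, hb⟩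
        · exact Or.inl h
        · refine Or.inr ⟨b, (s i).subset (s i).diag ?_⟩
          rintro ⟨c, d⟩ ⟨hc, hd⟩
          have h1 : (⟨i, c⟩ : Σ i, X i) = ⟨i, b⟩ := hc.trans hb.symm
          have h2 : d = b := hd
          exact (sigma_mk_injective h1).trans h2.symm
      apply bounded_of_prod
      refine (s i).subset ((s i).union
        ((s i).union ((sing x).prod (sing x)) ((sing x).prod (sing y)))
        ((s i).union ((sing y).prod (sing x)) ((sing y).prod (sing y)))) ?_
      rintro ⟨a, b⟩ ⟨hx | hx, hy | hy⟩
      · exact Or.inl (Or.inl ⟨hx, hy⟩)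
      · exact Or.inl (Or.inr ⟨hx, hy⟩)
      · exact Or.inr (Or.inl ⟨hx, hy⟩)
      · exact Or.inr (Or.inr ⟨hx, hy⟩)
    · rintro _ rfl
      exact Or.inr (mem_iUnion.2 ⟨x.1, mem_iUnion.2 ⟨y.1,
        ⟨x.2, Or.inl rfl, rfl⟩, ⟨y.2, Or.inr rfl, rfl⟩⟩⟩)

end CoarseStructure

/-- A coarse space. -/
structure CoarseSpace : Type (u + 1) where
  carrier : Type u
  str : CoarseStructure carrier

/-- A map between sets with coarse structures is coarse: it is controlled, and inverse images of
bounded sets are bounded. -/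
structure IsCoarseMap {X : Type u} {Y : Type v} (s : CoarseStructure X) (t : CoarseStructure Y)
    (f : X → Y) : Prop where
  controlled : ∀ M, s.Controlled M → t.Controlled (Prod.map f f '' M)
  proper : ∀ B, t.Bounded B → s.Bounded (f ⁻¹' B)

namespace CoarseSpace

/-- A coarse map. -/
@[ext]
structure Hom (X Y : CoarseSpace.{u}) where
  toFun : X.carrier → Y.carrier
  isCoarse : IsCoarseMap X.str Y.str toFun

/-- The coarse category. -/
instance : Category CoarseSpace.{u} where
  Hom X Y := Hom X Y
  id X := ⟨id, ⟨fun M h => by simpa using h, fun B h => h⟩⟩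
  comp f g := ⟨g.toFun ∘ f.toFun, ⟨fun M h => by
    have := g.isCoarse.controlled _ (f.isCoarse.controlled M h)
    rwa [← image_comp, Prod.map_comp_map] at this,
    fun B h => f.isCoarse.proper _ (g.isCoarse.proper B h)⟩⟩

/-- A subset of a coarse space, as a coarse space. -/
def sub (X : CoarseSpace.{u}) (A : Set X.carrier) : CoarseSpace.{u} := ⟨A, X.str.sub A⟩

/-- The inclusion of a subspace. -/
def subIncl (X : CoarseSpace.{u}) (A : Set X.carrier) : X.sub A ⟶ X :=
  ⟨Subtype.val, ⟨fun M h => h, fun B h => by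
    apply CoarseStructure.bounded_of_prod
    refine X.str.subset (h.prod h) ?_
    rintro _ ⟨⟨a, b⟩, ⟨ha, hb⟩, rfl⟩
    exact ⟨ha, hb⟩⟩⟩

/-- The inclusion of a subspace in a larger one. -/
def inclOfLE (X : CoarseSpace.{u}) {A B : Set X.carrier} (h : A ⊆ B) : X.sub A ⟶ X.sub B :=
  ⟨Set.inclusion h, ⟨fun M hM => by
    refine X.str.subset hM ?_
    rintro _ ⟨_, ⟨q, hq, rfl⟩, rfl⟩
    exact ⟨q, hq, rfl⟩, fun S hS => by
    apply CoarseStructure.bounded_of_prod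
    refine X.str.subset (hS.prod hS) ?_
    rintro _ ⟨⟨a, b⟩, ⟨ha, hb⟩, rfl⟩
    exact ⟨(Set.inclusion h a, Set.inclusion h b), ⟨ha, hb⟩, rfl⟩⟩⟩

/-- The coarse disjoint union of coarse spaces. -/
def disjUnion {ι : Type u} (X : ι → CoarseSpace.{u}) : CoarseSpace.{u} :=
  ⟨Σ i, (X i).carrier, CoarseStructure.disjUnion fun i => (X i).str⟩

/-- The canonical inclusion in the coarse disjoint union. -/
def disjIncl {ι : Type u} (X : ι → CoarseSpace.{u}) (i : ι) : X i ⟶ disjUnion X :=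
  ⟨fun x => (⟨i, x⟩ : Σ i, (X i).carrier), by
    classical
    constructor
    · intro M hM
      refine ⟨fun j => if h : i = j then h ▸ M else {p | p.1 = p.2}, fun j => ∅, fun j => ?_,
        fun j => Or.inl rfl, ?_⟩
      · dsimp only
        split_ifs with h
        · subst h; exact hM
        · exact (X j).str.diag
      · rintro _ ⟨q, hq, rfl⟩
        exact Or.inl (mem_iUnion.2 ⟨i, q, by simpa using hq, rfl⟩)
    · intro B hB
      obtain ⟨N, C, hN, hC, h⟩ := CoarseStructure.Bounded.prod hB hB
      apply CoarseStructure.bounded_of_prod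
      refine (X i).str.subset ((X i).str.union (hN i) ((hC i).prod (hC i))) ?_
      rintro ⟨a, b⟩ ⟨ha, hb⟩
      rcases h (show ((⟨i, a⟩, ⟨i, b⟩) : (Σ i, (X i).carrier) × (Σ i, (X i).carrier)) ∈ B ×ˢ B
        from ⟨ha, hb⟩) with h | h
      · obtain ⟨j, ⟨c, d⟩, hq, e⟩ := mem_iUnion.1 h
        simp only [Prod.map_apply, Prod.mk.injEq] at e
        obtain ⟨e1, e2⟩ := e
        obtain ⟨rfl, e1⟩ := Sigma.mk.inj_iff.1 e1
        obtain rfl := eq_of_heq e1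
        obtain rfl := sigma_mk_injective e2
        exact Or.inl hq
      · obtain ⟨j, h⟩ := mem_iUnion.1 h
        obtain ⟨k, ⟨c, hc, e1⟩, ⟨d, hd, e2⟩⟩ := mem_iUnion.1 h
        obtain ⟨rfl, e1⟩ := Sigma.mk.inj_iff.1 e1
        obtain rfl := eq_of_heq e1
        obtain ⟨rfl, e2⟩ := Sigma.mk.inj_iff.1 e2
        obtain rfl := eq_of_heq e2
        exact Or.inr ⟨hc, hd⟩⟩

/-! ### Coarse homotopy -/

/-- Generalised rays: coarse structures on `[0,∞)` compatible with the topology, for which sums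
`M + N`, the sets `M^s` and translates `a + M` of controlled sets are controlled. -/
structure IsGeneralisedRay (r : CoarseStructure ℝ≥0) : Prop where
  compatible : r.CompatibleWithTopology
  add : ∀ M N, r.Controlled M → r.Controlled N →
    r.Controlled {q | ∃ m ∈ M, ∃ n ∈ N, q = (m.1 + n.1, m.2 + n.2)}
  between : ∀ M, r.Controlled M →
    r.Controlled {q | ∃ m ∈ M, m.1 ≤ q.1 ∧ q.1 ≤ m.2 ∧ m.1 ≤ q.2 ∧ q.2 ≤ m.2}
  translate : ∀ M, r.Controlled M → ∀ a : ℝ≥0,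
    r.Controlled {q | ∃ m ∈ M, q = (a + m.1, a + m.2)}

/-- The `p`-cylinder `I_p X`, as a subspace of the product `X × R`. -/
def cylinder (X : CoarseSpace.{u}) (r : CoarseStructure ℝ≥0) (p : X.carrier → ℝ≥0) :
    CoarseSpace.{u} :=
  CoarseSpace.sub ⟨X.carrier × ℝ≥0, X.str.prod r⟩ {q | q.2 ≤ p q.1 + 1}

/-- Elementary coarse homotopies. -/
def ElementaryHomotopic {X Y : CoarseSpace.{u}} (f₀ f₁ : X ⟶ Y) : Prop :=
  ∃ (r : CoarseStructure ℝ≥0) (p : X.carrier → ℝ≥0),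
    IsGeneralisedRay r ∧ IsCoarseMap X.str r p ∧
      ∃ H : X.cylinder r p ⟶ Y,
        (∀ x, f₀.toFun x = H.toFun ⟨(x, 0), bot_le (a := p x + 1)⟩) ∧
          ∀ x, f₁.toFun x = H.toFun ⟨(x, p x + 1), le_refl (p x + 1)⟩

/-- Coarsely homotopic maps: linked by a chain of elementary coarse homotopies. -/
def CoarselyHomotopic {X Y : CoarseSpace.{u}} (f₀ f₁ : X ⟶ Y) : Prop :=
  Relation.EqvGen ElementaryHomotopic f₀ f₁

/-- Coarse homotopy equivalences. -/
def IsCoarseHomotopyEquiv {X Y : CoarseSpace.{u}} (f : X ⟶ Y) : Prop :=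
  ∃ g : Y ⟶ X, CoarselyHomotopic (f ≫ g) (𝟙 X) ∧ CoarselyHomotopic (g ≫ f) (𝟙 Y)

/-- Flasque coarse spaces. -/
def Flasque (X : CoarseSpace.{u}) : Prop :=
  ∃ t : X.carrier → X.carrier,
    (∀ B, X.str.Bounded B → ∃ N : ℕ, ∀ n ≥ N, range t^[n] ∩ B = ∅) ∧
    (∀ M, X.str.Controlled M → X.str.Controlled (⋃ n : ℕ, Prod.map t^[n] t^[n] '' M)) ∧
    X.str.Close t id

/-- A coarsely excisive decomposition `X = A ∪ B`. -/
def CoarselyExcisiveDecomposition (X : CoarseSpace.{u}) (A B : Set X.carrier) : Prop :=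
  A ∪ B = univ ∧ ∀ m, X.str.Controlled m →
    ∃ M, X.str.Controlled M ∧ relImage m A ∩ relImage m B ⊆ relImage M (A ∩ B)

end CoarseSpace

open CoarseSpace in
/-- Coarsely excisive functors from the coarse category to the category of spectra. -/
structure IsCoarselyExcisive (E : CoarseSpace.{u} ⥤ TopSpectrum.{v}) : Prop where
  flasque : ∀ X : CoarseSpace.{u}, X.Flasque → (E.obj X).WeaklyContractible
  homotopy : ∀ (X Y : CoarseSpace.{u}) (f : X ⟶ Y), IsCoarseHomotopyEquiv f →
    TopSpectrum.Hom.IsWeakEquiv (E.map f)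
  excision : ∀ (X : CoarseSpace.{u}) (A B : Set X.carrier), X.CoarselyExcisiveDecomposition A B →
    TopSpectrum.IsHomotopyPushout
      (E.map (X.inclOfLE (A := A ∩ B) (B := A) inter_subset_left))
      (E.map (X.inclOfLE (A := A ∩ B) (B := B) inter_subset_right))
      (E.map (X.subIncl A)) (E.map (X.subIncl B))
  disjoint : ∀ (ι : Type u) (X : ι → CoarseSpace.{u}),
    TopSpectrum.Hom.IsWeakEquiv (TopSpectrum.wedgeDesc fun i => E.map (disjIncl X i))

/-! ### The open cone -/

section Cone

variable (X : Type u) [TopologicalSpace X]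

/-- The relation that collapses `X × {0}` to the apex of the cone. -/
inductive ConeRel : PUnit.{u + 1} ⊕ X × I → PUnit.{u + 1} ⊕ X × I → Prop
  | apex (x : X) : ConeRel (Sum.inr (x, 0)) (Sum.inl PUnit.unit)

/-- The closed cone `(X × [0,1]) / (X × {0})` (for empty `X`, the quotient is one point). -/
def Cone : Type u := Quot (ConeRel X)

instance : TopologicalSpace (Cone X) := inferInstanceAs (TopologicalSpace (Quot (ConeRel X)))

instance [CompactSpace X] : CompactSpace (Cone X) :=
  inferInstanceAs (CompactSpace (Quot (ConeRel X)))

variable {X}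

/-- The point `[x, t]` of the cone. -/
def Cone.mk (x : X) (t : I) : Cone X := Quot.mk _ (Sum.inr (x, t))

/-- The coordinate `[x, t] ↦ t`. -/
def Cone.height : Cone X → I :=
  Quot.lift (Sum.elim (fun _ => 0) Prod.snd) (by rintro _ _ ⟨x⟩; rfl)

theorem Cone.continuous_height : Continuous (Cone.height (X := X)) :=
  continuous_quot_lift _ (continuous_sum_dom.2 ⟨continuous_const, continuous_snd⟩)

/-- The points `[x, t]` with `x ∈ U` and `t > 0`. -/
def Cone.over (U : Set X) : Set (Cone X) :=
  {c | Quot.lift (Sum.elim (fun _ => False) (fun p : X × I => p.1 ∈ U ∧ 0 < p.2))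
    (by rintro _ _ ⟨x⟩; simp) c}

theorem Cone.isOpen_over {U : Set X} (hU : IsOpen U) : IsOpen (Cone.over U) := by
  refine isOpen_coinduced.2 (isOpen_sum_iff.2 ⟨?_, ?_⟩)
  · exact isOpen_empty
  · exact (hU.preimage continuous_fst).inter
      (isOpen_lt continuous_const continuous_snd : IsOpen {p : X × I | (0 : I) < p.2})

instance [T2Space X] : T2Space (Cone X) where
  t2 := by
    intro c d hcd
    by_cases h : c.height = d.height
    · have key : ∀ e : Cone X, e = Quot.mk _ (Sum.inl PUnit.unit) ∨
          ∃ x t, 0 < t ∧ e = Cone.mk x t := by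
        intro e
        induction e using Quot.ind with | mk p => ?_
        rcases p with _ | ⟨x, t⟩
        · exact Or.inl rfl
        · rcases eq_or_ne t 0 with rfl | ht
          · exact Or.inl (Quot.sound (ConeRel.apex x))
          · exact Or.inr ⟨x, t, unitInterval.pos_iff_ne_zero.2 ht, rfl⟩
      rcases key c with rfl | ⟨x, t, ht, rfl⟩ <;> rcases key d with rfl | ⟨y, r, hr, rfl⟩
      · exact absurd rfl hcd
      · exact absurd h hr.ne
      · exact absurd h.symm ht.ne
      · obtain rfl : t = r := h
        have hxy : x ≠ y := by rintro rfl; exact hcd rfl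
        obtain ⟨U, V, hU, hV, hx, hy, hUV⟩ := t2_separation hxy
        refine ⟨_, _, Cone.isOpen_over hU, Cone.isOpen_over hV, ⟨hx, ht⟩, ⟨hy, hr⟩, ?_⟩
        refine Set.disjoint_left.2 fun e => ?_
        induction e using Quot.ind with | mk p => ?_
        rcases p with _ | ⟨z, q⟩
        · exact fun h => h.elim
        · exact fun h h' => Set.disjoint_left.1 hUV h.1 h'.1
    · obtain ⟨U, V, hU, hV, hx, hy, hUV⟩ := t2_separation h
      exact ⟨_, _, hU.preimage Cone.continuous_height, hV.preimage Cone.continuous_height, hx, hy,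
        hUV.preimage _⟩

/-- The map of closed cones induced by a continuous map. -/
def Cone.map {Y : Type u} [TopologicalSpace Y] (f : C(X, Y)) : Cone X → Cone Y :=
  Quot.map (Sum.map id (Prod.map f id)) (by rintro _ _ ⟨x⟩; exact ConeRel.apex (f x))

theorem Cone.continuous_map {Y : Type u} [TopologicalSpace Y] (f : C(X, Y)) :
    Continuous (Cone.map f) :=
  continuous_quot_lift _ (continuous_quot_mk.comp
    (continuous_id.sumMap (f.continuous.prodMap continuous_id)))

theorem Cone.height_map {Y : Type u} [TopologicalSpace Y] (f : C(X, Y)) (c : Cone X) :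
    (Cone.map f c).height = c.height := by
  induction c using Quot.ind with | mk p => ?_
  rcases p with _ | ⟨x, t⟩ <;> rfl

variable (X) in
/-- The underlying set of the open cone `(X × [0,1)) / (X × {0})`, inside the closed cone. -/
def OpenCone : Type u := {c : Cone X // c.height < 1}

/-- A subset of `𝒪X × 𝒪X` as a subset of the square of the compactification. -/
def OpenCone.lift (M : Set (OpenCone X × OpenCone X)) : Set (Cone X × Cone X) :=
  (fun p => (p.1.1, p.2.1)) '' M

variable (X) in
/-- The continuously controlled coarse structure on the open cone: `M` is controlled if its closure
in the square of the compactification meets the pairs with at least one point at infinity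
(height `1`) only in the diagonal. -/
def continuouslyControlled [CompactSpace X] [T2Space X] : CoarseStructure (OpenCone X) where
  Controlled M := ∀ p ∈ closure (OpenCone.lift M), p.1.height = 1 ∨ p.2.height = 1 → p.1 = p.2
  union {M N} h k p hp := by
    rw [OpenCone.lift, image_union, closure_union] at hp
    exact hp.elim (h p) (k p)
  subset h k p hp := h p (closure_mono (image_mono k) hp)
  symm {M} h p hp hb := by
    refine (h p.swap ?_ hb.symm).symm
    have := map_mem_closure continuous_swap hp (t := OpenCone.lift M) (by
      rintro _ ⟨q, hq, rfl⟩
      exact ⟨q.swap, hq, rfl⟩)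
    exact this
  comp {M N} h k := by
    rintro ⟨a, c⟩ hp hb
    obtain ⟨F, hF, hlim⟩ := mem_closure_iff_ultrafilter.1 hp
    have hex : ∀ q : Cone X × Cone X, ∃ y : Cone X, q ∈ OpenCone.lift (relComp M N) →
        (q.1, y) ∈ OpenCone.lift M ∧ (y, q.2) ∈ OpenCone.lift N := by
      intro q
      by_cases hq : q ∈ OpenCone.lift (relComp M N)
      · obtain ⟨p, ⟨y, hy, hy'⟩, rfl⟩ := hq
        exact ⟨y.1, fun _ => ⟨⟨_, hy, rfl⟩, ⟨_, hy', rfl⟩⟩⟩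
      · exact ⟨q.1, fun h => absurd h hq⟩
    choose y hy using hex
    obtain ⟨b, -, hb'⟩ := isCompact_univ.ultrafilter_le_nhds (F.map y) (by simp)
    have hyb : Filter.Tendsto y F (𝓝 b) := hb'
    have h1 : Filter.Tendsto (fun q : Cone X × Cone X => q.1) F (𝓝 a) :=
      (continuous_fst.tendsto (a, c)).mono_left hlim
    have h2 : Filter.Tendsto (fun q : Cone X × Cone X => q.2) F (𝓝 c) :=
      (continuous_snd.tendsto (a, c)).mono_left hlim
    have hab : (a, b) ∈ closure (OpenCone.lift M) :=
      mem_closure_of_tendsto (h1.prodMk_nhds hyb)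
        (Filter.mem_of_superset hF fun q hq => (hy q hq).1)
    have hbc : (b, c) ∈ closure (OpenCone.lift N) :=
      mem_closure_of_tendsto (hyb.prodMk_nhds h2)
        (Filter.mem_of_superset hF fun q hq => (hy q hq).2)
    rcases hb with ha | hc
    · have e : a = b := h _ hab (Or.inl ha)
      subst e
      exact k _ hbc (Or.inl ha)
    · have e : b = c := k _ hbc (Or.inr hc)
      subst e
      exact h _ hab (Or.inr hc)
  diag p hp _ := by
    have : closure (OpenCone.lift {p : OpenCone X × OpenCone X | p.1 = p.2}) ⊆
        {p : Cone X × Cone X | p.1 = p.2} := by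
      refine closure_minimal ?_ (isClosed_eq continuous_fst continuous_snd)
      rintro _ ⟨q, hq, rfl⟩
      exact congrArg Subtype.val hq
    exact this hp
  connected x y := by
    refine ⟨{(x, y)}, fun p hp hb => ?_, rfl⟩
    rw [OpenCone.lift, image_singleton, closure_singleton, mem_singleton_iff] at hp
    subst hp
    exact (hb.elim x.2.ne y.2.ne).elim

end Cone

/-- The open cone `𝒪X` of a compact Hausdorff space, as a coarse space. -/
def openCone (X : CompHaus.{u}) : CoarseSpace.{u} := ⟨OpenCone X, continuouslyControlled X⟩

/-- The map of open cones induced by a continuous map, `[x, t] ↦ [f x, t]`, is coarse. -/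
def openConeMap {X Y : CompHaus.{u}} (f : X ⟶ Y) : openCone X ⟶ openCone Y :=
  ⟨fun c => ⟨Cone.map f.hom.hom c.1, by rw [Cone.height_map]; exact c.2⟩, by
    have key : ∀ M : Set (OpenCone X × OpenCone X),
        closure (OpenCone.lift (Prod.map
          (fun c : OpenCone X => (⟨Cone.map f.hom.hom c.1, by rw [Cone.height_map]; exact c.2⟩ :
            OpenCone Y))
          (fun c : OpenCone X => (⟨Cone.map f.hom.hom c.1, by rw [Cone.height_map]; exact c.2⟩ :
            OpenCone Y)) '' M)) ⊆
        Prod.map (Cone.map f.hom.hom) (Cone.map f.hom.hom) '' closure (OpenCone.lift M) := by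
      intro M
      have hc : Continuous (Prod.map (Cone.map f.hom.hom) (Cone.map f.hom.hom)) :=
        (Cone.continuous_map _).prodMap (Cone.continuous_map _)
      refine closure_minimal ?_ (isClosed_closure.isCompact.image hc).isClosed
      rintro _ ⟨_, ⟨q, hq, rfl⟩, rfl⟩
      exact ⟨_, subset_closure ⟨q, hq, rfl⟩, rfl⟩
    constructor
    · intro M hM p hp hb
      obtain ⟨q, hq, rfl⟩ := key M hp
      simp only [Prod.map_fst, Prod.map_snd, Cone.height_map] at hb ⊢
      rw [hM q hq hb]
    · intro B hB
      apply CoarseStructure.bounded_of_prod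
      have hB' := hB.prod hB
      have aux : ∀ c ∈ closure (Subtype.val '' (B : Set (OpenCone Y)) : Set (Cone Y)),
          Cone.height c ≠ 1 := by
        intro c hc h1
        rcases hB with rfl | ⟨x, hx⟩
        · obtain ⟨_, ⟨b, hb, -⟩⟩ := closure_nonempty_iff.1 ⟨c, hc⟩
          exact hb
        · have : (c, x.1) ∈ closure (OpenCone.lift (B ×ˢ {x})) := by
            have hcont : Continuous fun d : Cone Y => (d, x.1) := by fun_prop
            refine map_mem_closure (f := fun d : Cone Y => (d, x.1)) hcont hc ?_
            rintro _ ⟨b, hb, rfl⟩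
            exact ⟨(b, x), ⟨hb, rfl⟩, rfl⟩
          have e : c = x.1 := hx _ this (Or.inl h1)
          rw [e] at h1
          exact x.2.ne h1
      intro p hp hb
      exfalso
      rcases hb with hb | hb
      · refine aux (Cone.map f.hom.hom p.1) ?_ (by rw [Cone.height_map]; exact hb)
        refine map_mem_closure (f := fun q : Cone X × Cone X => Cone.map f.hom.hom q.1)
          ((Cone.continuous_map _).comp continuous_fst) hp ?_
        rintro _ ⟨q, hq, rfl⟩
        exact ⟨_, hq.1, rfl⟩
      · refine aux (Cone.map f.hom.hom p.2) ?_ (by rw [Cone.height_map]; exact hb)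
        refine map_mem_closure (f := fun q : Cone X × Cone X => Cone.map f.hom.hom q.2)
          ((Cone.continuous_map _).comp continuous_snd) hp ?_
        rintro _ ⟨q, hq, rfl⟩
        exact ⟨_, hq.2, rfl⟩⟩

/-- The open cone, as a functor from compact Hausdorff spaces to the coarse category. -/
def openConeFunctor : CompHaus.{u} ⥤ CoarseSpace.{u} where
  obj := openCone
  map := openConeMap
  map_id X := by
    apply CoarseSpace.Hom.ext
    funext c
    apply Subtype.ext
    rcases c with ⟨c, hc⟩
    induction c using Quot.ind with | mk p => ?_
    rcases p with _ | ⟨x, t⟩ <;> rfl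
  map_comp f g := by
    apply CoarseSpace.Hom.ext
    funext c
    apply Subtype.ext
    rcases c with ⟨c, hc⟩
    induction c using Quot.ind with | mk p => ?_
    rcases p with _ | ⟨x, t⟩ <;> rfl

/-- The open cone `𝒪U ⊆ 𝒪X` over a subset `U ⊆ X`: the apex and all `[x, t]` with `x ∈ U`. -/
def openConeOver (X : CompHaus.{u}) (U : Set X) : Set (openCone X).carrier :=
  {c | Cone.height c.1 = 0 ∨ ∃ x ∈ U, ∃ t, c.1 = Cone.mk x t}

theorem openConeOver_mono (X : CompHaus.{u}) {U V : Set X} (h : U ⊆ V) :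
    openConeOver X U ⊆ openConeOver X V := by
  rintro c (hc | ⟨x, hx, t, ht⟩)
  · exact Or.inl hc
  · exact Or.inr ⟨x, h hx, t, ht⟩

/-- The compact Hausdorff spaces that are homotopy equivalent to CW-complexes. -/
def hasCWType : ObjectProperty CompHaus.{u} := fun X =>
  ∃ (Y : Type u) (_ : TopologicalSpace Y) (_ : T2Space Y),
    Nonempty (Topology.CWComplex (univ : Set Y)) ∧ Nonempty (ContinuousMap.HomotopyEquiv X Y)

/-- The functor `X ↦ E(𝒪X)` on compact Hausdorff spaces homotopy equivalent to CW-complexes. -/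
def coneTheory (E : CoarseSpace.{u} ⥤ TopSpectrum.{v}) :
    hasCWType.{u}.FullSubcategory ⥤ TopSpectrum.{v} :=
  hasCWType.ι ⋙ openConeFunctor ⋙ E

/-!
Write `π_k(X)` for the stable homotopy groups of `E(X)`. The radial coordinate `r` of an open cone
`𝒪X` is in general not a coarse map to the metric ray `[0, ∞)`, so a homotopy of maps `X → Y` is
not directly a coarse homotopy of cones. It becomes one on the graph of `r` in `𝒪X × [0, ∞)`: the
second coordinate is a coarse map to the ray, and a homotopy can be run through on the interval
`[0, r + 1]`. Passing to the graph costs little. The product `𝒪X × [0, ∞)` is flasque, and its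
subsets below and above the graph form a coarsely excisive decomposition, so by excision `π_k` of
the graph maps onto `π_k` of the part below it, which retracts onto `𝒪X`. Hence the graph
surjects onto `𝒪X` on `π_k`, and a homotopy equivalence `X → Y` induces surjections
`π_k(𝒪X) → π_k(𝒪Y)`. This suffices: the end inclusions of the cylinder `X × I` are homotopy
equivalences, so they induce split injections that are also surjective; both are inverse to the
map induced by the projection, hence equal, and `X ↦ π_k(𝒪X)` is homotopy invariant.

Excision holds because continuous control relates the points over two disjoint closed subsets of
`X` only in a bounded region, so that open covers give coarsely excisive decompositions of the cone.

By compactness only finitely many summands of a disjoint union are nonempty, and as long as there is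
a summand at all, the cone differs from the coarse disjoint union of the cones only in the
identification of the apexes, which is a coarse homotopy equivalence. The empty family needs
`E(𝒪∅)` to be weakly contractible: as the empty space is the disjoint union of two copies of itself,
the fold map of `E(𝒪∅)` is a weak equivalence, which forces this.
-/

/-! ### Stable homotopy groups -/

namespace TopSpectrum

section MapPi

variable {A : TopSpectrum.{u}} {B : TopSpectrum.{v}} {C : TopSpectrum.{w}}

/-- The composite of maps between spectra that may live in different universes. -/
def Hom.comp (f : Hom A B) (g : Hom B C) : Hom A C where
  app n := (g.app n).comp (f.app n)
  app_pt n := by simp [f.app_pt, g.app_pt]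
  app_adj n x s := by simp [f.app_adj, g.app_adj]

theorem Hom.mapPi_comp (f : Hom A B) (g : Hom B C) (k : ℤ) :
    (f.comp g).mapPi k = g.mapPi k ∘ f.mapPi k := by
  funext a
  induction a using Quot.ind with | mk r => rfl

theorem mapPi_id (A : TopSpectrum.{v}) (k : ℤ) : Hom.mapPi (𝟙 A) k = id := by
  funext a
  induction a using Quot.ind with | mk r => rfl

/-- The stable homotopy group `π_k` as a set-valued functor. -/
def stablePiFunctor (k : ℤ) : TopSpectrum.{v} ⥤ Type v where
  obj A := StablePi A k
  map f := ↾(Hom.mapPi f k)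
  map_id A := by rw [mapPi_id]; rfl
  map_comp f g := congrArg (fun φ => ↾φ) (Hom.mapPi_comp f g k)

/-- The generalised loop induced by a map of spectra. -/
def Hom.mapLoop (f : Hom A B) {n m : ℕ} (γ : GenLoop (Fin m) (A.space n) (A.pt n)) :
    GenLoop (Fin m) (B.space n) (B.pt n) :=
  ⟨(f.app n).comp γ.1, fun y hy => (congrArg (f.app n) (γ.2 y hy)).trans (f.app_pt n)⟩

end MapPi

theorem mem_boundary_succ_iff {m : ℕ} {y : Fin (m + 1) → I} :
    y ∈ Cube.boundary (Fin (m + 1)) ↔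
      (y 0 = 0 ∨ y 0 = 1) ∨ Fin.tail y ∈ Cube.boundary (Fin m) :=
  Fin.exists_fin_succ

section ConsLoop

variable {Y : Type v} [TopologicalSpace Y] {y₀ : Y} {m : ℕ}

/-- The generalised loop `y ↦ Φ (y 0, Fin.tail y)` given by a map `Φ` on `I × I^m` that is
constant on the boundary. -/
def consLoop (Φ : C(I × (Fin m → I), Y)) (h₀ : ∀ z, Φ (0, z) = y₀) (h₁ : ∀ z, Φ (1, z) = y₀)
    (hb : ∀ s, ∀ z ∈ Cube.boundary (Fin m), Φ (s, z) = y₀) : GenLoop (Fin (m + 1)) Y y₀ :=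
  ⟨⟨fun y => Φ (y 0, Fin.tail y), by fun_prop⟩, fun y hy => by
    change Φ (y 0, Fin.tail y) = y₀
    rcases mem_boundary_succ_iff.1 hy with (hy | hy) | hy
    · rw [hy, h₀]
    · rw [hy, h₁]
    · exact hb _ _ hy⟩

theorem homotopic_diagonal (Φ : C(I × I × (Fin m → I), Y)) (h₀ : ∀ z, Φ (0, 0, z) = y₀)
    (h₁ : ∀ t z, Φ (1, t, z) = y₀) (hb : ∀ s t, ∀ z ∈ Cube.boundary (Fin m), Φ (s, t, z) = y₀)
    {γ δ : GenLoop (Fin (m + 1)) Y y₀} (hγ : ∀ y, γ.1 y = Φ (y 0, 0, Fin.tail y))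
    (hδ : ∀ y, δ.1 y = Φ (y 0, y 0, Fin.tail y)) : GenLoop.Homotopic γ δ := by
  refine ⟨{ toFun := fun p => Φ (p.2 0, p.1 * p.2 0, Fin.tail p.2)
            continuous_toFun := by fun_prop
            map_zero_left := fun y => ?_
            map_one_left := fun y => ?_
            prop' := fun t y hy => ?_ }⟩
  · rw [zero_mul, hγ]
  · rw [one_mul, hδ]
  · refine Eq.trans ?_ (γ.2 y hy).symm
    rcases mem_boundary_succ_iff.1 hy with (hy | hy) | hy
    · simp only [ContinuousMap.coe_mk, hy, mul_zero, h₀]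
    · simp only [ContinuousMap.coe_mk, hy, h₁]
    · exact hb _ _ _ hy

theorem homotopic_of_square (Φ : C(I × I × (Fin m → I), Y)) (h₀ : ∀ z, Φ (0, 0, z) = y₀)
    (h₁ : ∀ t z, Φ (1, t, z) = y₀) (h₁' : ∀ s z, Φ (s, 1, z) = y₀)
    (hb : ∀ s t, ∀ z ∈ Cube.boundary (Fin m), Φ (s, t, z) = y₀)
    {γ δ : GenLoop (Fin (m + 1)) Y y₀} (hγ : ∀ y, γ.1 y = Φ (y 0, 0, Fin.tail y))
    (hδ : ∀ y, δ.1 y = Φ (0, y 0, Fin.tail y)) : GenLoop.Homotopic γ δ := by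
  let diagonal : GenLoop (Fin (m + 1)) Y y₀ :=
    consLoop ⟨fun p => Φ (p.1, p.1, p.2), by fun_prop⟩ h₀ (h₁ 1) fun s => hb s s
  let swapped : C(I × I × (Fin m → I), Y) := ⟨fun p => Φ (p.2.1, p.1, p.2.2), by fun_prop⟩
  exact (homotopic_diagonal Φ h₀ h₁ hb (δ := diagonal) hγ fun _ => rfl).trans
    (homotopic_diagonal swapped h₀ (fun t z => h₁' t z) (fun s t => hb t s) (δ := diagonal) hδ
      fun _ => rfl).symm

end ConsLoop

section EventuallyNull

variable (A : TopSpectrum.{v})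

theorem stab_const (n m : ℕ) :
    A.stab (GenLoop.const : GenLoop (Fin m) (A.space n) (A.pt n)) = GenLoop.const :=
  Subtype.ext (ContinuousMap.ext fun _ => A.adj_pt n _)

theorem mk_const_eq {k : ℤ} {n m n' m' : ℕ} (h : (m : ℤ) = n + k) (h' : (m' : ℤ) = n' + k) :
    (Quot.mk _ ⟨n, m, h, GenLoop.const⟩ : StablePi A k) =
      Quot.mk _ ⟨n', m', h', GenLoop.const⟩ := by
  wlog hn : n ≤ n' generalizing n n' m m'
  · exact (this h' h (le_of_not_ge hn)).symm
  induction n', hn using Nat.le_induction generalizing m' with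
  | base =>
    obtain rfl : m' = m := by omega
    rfl
  | succ n' hn ih =>
    obtain _ | m' := m'
    · omega
    rw [ih (m' := m') (by omega), ← stab_const]
    exact Quot.sound (StableRel.stab n' m' (by omega) _)

variable {A} {n m : ℕ} {γ γ' : GenLoop (Fin m) (A.space n) (A.pt n)}

theorem stab_homotopic (h : GenLoop.Homotopic γ γ') :
    GenLoop.Homotopic (A.stab γ) (A.stab γ') := by
  obtain ⟨F⟩ := h
  refine ⟨{ toFun := fun p => A.adj n (F (p.1, Fin.tail p.2)) (p.2 0)
            continuous_toFun := by fun_prop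
            map_zero_left := fun y => congrArg (A.adj n · (y 0)) (F.map_zero_left _)
            map_one_left := fun y => congrArg (A.adj n · (y 0)) (F.map_one_left _)
            prop' := fun t y hy => ?_ }⟩
  refine Eq.trans ?_ ((A.stab γ).2 y hy).symm
  change A.adj n (F (t, Fin.tail y)) (y 0) = _
  rcases mem_boundary_succ_iff.1 hy with (hy | hy) | hy
  · rw [hy, A.adj_zero]
  · rw [hy, A.adj_one]
  · rw [F.eq_fst t hy, γ.2 _ hy, A.adj_pt]

variable (A) in
/-- The generalised loops that become null homotopic after finitely many stabilizations. -/
inductive EventuallyNull : ∀ {n m : ℕ}, GenLoop (Fin m) (A.space n) (A.pt n) → Prop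
  | null {n m : ℕ} {γ : GenLoop (Fin m) (A.space n) (A.pt n)} :
      GenLoop.Homotopic γ GenLoop.const → EventuallyNull γ
  | of_stab {n m : ℕ} {γ : GenLoop (Fin m) (A.space n) (A.pt n)} :
      EventuallyNull (A.stab γ) → EventuallyNull γ

theorem EventuallyNull.congr (hγ : A.EventuallyNull γ) (h : GenLoop.Homotopic γ γ') :
    A.EventuallyNull γ' := by
  induction hγ with
  | null hγ => exact .null (h.symm.trans hγ)
  | of_stab _ ih => exact .of_stab (ih (stab_homotopic h))

theorem eventuallyNull_stab_iff : A.EventuallyNull (A.stab γ) ↔ A.EventuallyNull γ := by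
  refine ⟨.of_stab, fun h => ?_⟩
  cases h with
  | null h => exact .null (stab_const A n m ▸ stab_homotopic h)
  | of_stab h => exact h

theorem eventuallyNull_of_mk_eq_const {k : ℤ} {h : (m : ℤ) = n + k}
    (e : (Quot.mk _ ⟨n, m, h, γ⟩ : StablePi A k) = Quot.mk _ ⟨n, m, h, GenLoop.const⟩) :
    A.EventuallyNull γ := by
  let P : StablePi A k → Prop := Quot.lift (fun r => A.EventuallyNull r.loop) (by
    rintro _ _ (⟨n, m, h, γ, γ', H⟩ | ⟨n, m, h, γ⟩)
    · exact propext ⟨fun hγ => hγ.congr H, fun hγ => hγ.congr H.symm⟩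
    · exact propext eventuallyNull_stab_iff.symm)
  have hP : P (Quot.mk _ ⟨n, m, h, GenLoop.const⟩) :=
    EventuallyNull.null (GenLoop.Homotopic.refl _)
  rw [← e] at hP
  exact hP

end EventuallyNull

/-! ### The double mapping cylinder -/

section Cylinder

variable {A B C D : TopSpectrum.{v}} (f : A ⟶ B) (g : A ⟶ C)

/-- The inclusion of the left end in the double mapping cylinder. -/
def cylLeft : B ⟶ cyl f g where
  app n := ⟨fun b => Quot.mk _ (Sum.inl (Sum.inl b)), by fun_prop⟩
  app_pt _ := rfl
  app_adj _ _ _ := rfl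

/-- The connecting map of the double mapping cylinder, which collapses both ends and is
`(a, τ) ↦ adj a τ` on the cylinder. -/
def cylConnecting (n : ℕ) : C((cyl f g).space n, A.space (n + 1)) where
  toFun := Quot.lift (Sum.elim (fun _ => A.pt (n + 1)) (fun p => A.adj n p.1 p.2)) (by
    rintro _ _ (a | a | t)
    · exact A.adj_zero n a
    · exact A.adj_one n a
    · exact A.adj_pt n t)
  continuous_toFun := continuous_quot_lift _ (by
    refine continuous_sum_dom.2 ⟨continuous_const, ?_⟩
    change Continuous fun p : A.space n × I => A.adj n p.1 p.2
    fun_prop)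

/-- A contraction of the composite of the connecting map with `f`, which on the left end is the
adjoint structure map of `B`. -/
def cylContraction (n : ℕ) : C((cyl f g).space n, C(I, B.space (n + 1))) where
  toFun := Quot.lift
    (Sum.elim (Sum.elim (B.adj n) (fun _ => ContinuousMap.const I (B.pt (n + 1))))
      (fun p => (⟨fun q : (A.space n × I) × I => B.adj n (f.app n q.1.1) (q.1.2 ⊔ q.2),
        by fun_prop⟩ : C((A.space n × I) × I, B.space (n + 1))).curry p)) (by
    rintro _ _ (a | a | t)
    · ext s
      change B.adj n (f.app n a) (0 ⊔ s) = B.adj n (f.app n a) s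
      rw [sup_eq_right.2 nonneg']
    · ext s
      change B.adj n (f.app n a) (1 ⊔ s) = B.pt (n + 1)
      rw [sup_eq_left.2 le_one', B.adj_one]
    · ext s
      change B.adj n (f.app n (A.pt n)) (t ⊔ s) = B.adj n (B.pt n) s
      rw [f.app_pt, B.adj_pt, B.adj_pt])
  continuous_toFun := continuous_quot_lift _ (continuous_sum_dom.2
    ⟨continuous_sum_dom.2 ⟨(B.adj n).continuous, continuous_const⟩, ContinuousMap.continuous _⟩)

theorem cylContraction_zero (n : ℕ) (z : (cyl f g).space n) :
    cylContraction f g n z 0 = f.app (n + 1) (cylConnecting f g n z) := by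
  induction z using Quot.ind with | mk p => ?_
  rcases p with (b | _) | ⟨a, t⟩
  · exact (B.adj_zero n b).trans (f.app_pt _).symm
  · exact (f.app_pt _).symm
  · change B.adj n (f.app n a) (t ⊔ 0) = f.app (n + 1) (A.adj n a t)
    rw [sup_eq_left.2 nonneg', f.app_adj]

theorem cylContraction_one (n : ℕ) (z : (cyl f g).space n) :
    cylContraction f g n z 1 = B.pt (n + 1) := by
  induction z using Quot.ind with | mk p => ?_
  rcases p with (b | _) | ⟨a, t⟩
  · exact B.adj_one n b
  · rfl
  · change B.adj n (f.app n a) (t ⊔ 1) = _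
    rw [sup_eq_right.2 le_one', B.adj_one]

theorem exists_homotopic_stab_of_cylLeft_null {n m : ℕ}
    (γ : GenLoop (Fin m) (B.space n) (B.pt n))
    (hγ : GenLoop.Homotopic ((cylLeft f g).mapLoop γ) GenLoop.const) :
    ∃ δ : GenLoop (Fin (m + 1)) (A.space (n + 1)) (A.pt (n + 1)),
      GenLoop.Homotopic (Hom.mapLoop f δ) (B.stab γ) := by
  obtain ⟨Γ⟩ := hγ
  have Γ_zero : ∀ z, Γ (0, z) = (cylLeft f g).app n (γ.1 z) := Γ.map_zero_left
  have Γ_one : ∀ z, Γ (1, z) = (cyl f g).pt n := Γ.map_one_left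
  have Γ_boundary : ∀ s, ∀ z ∈ Cube.boundary (Fin m), Γ (s, z) = (cyl f g).pt n :=
    fun s z hz => Γ.eq_snd s hz
  have contraction_pt : ∀ t, cylContraction f g n ((cyl f g).pt n) t = B.pt (n + 1) := B.adj_pt n
  let δ : GenLoop (Fin (m + 1)) (A.space (n + 1)) (A.pt (n + 1)) :=
    consLoop ((cylConnecting f g n).comp Γ.toContinuousMap)
      (fun z => congrArg (cylConnecting f g n) (Γ_zero z))
      (fun z => congrArg (cylConnecting f g n) (Γ_one z))
      (fun s z hz => congrArg (cylConnecting f g n) (Γ_boundary s z hz))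
  let Φ : C(I × I × (Fin m → I), B.space (n + 1)) :=
    ⟨fun p => cylContraction f g n (Γ (p.1, p.2.2)) p.2.1, by fun_prop⟩
  refine ⟨δ, homotopic_of_square Φ (fun z => ?_) (fun t z => ?_) (fun s z => ?_)
    (fun s t z hz => ?_) (fun y => ?_) (fun y => ?_)⟩
  · exact (congrArg (cylContraction f g n · 0) (Γ_zero z)).trans (B.adj_zero n _)
  · exact (congrArg (cylContraction f g n · t) (Γ_one z)).trans (contraction_pt t)
  · exact cylContraction_one f g n _
  · exact (congrArg (cylContraction f g n · t) (Γ_boundary s z hz)).trans (contraction_pt t)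
  · exact (cylContraction_zero f g n _).symm
  · exact (congrArg (cylContraction f g n · (y 0)) (Γ_zero (Fin.tail y))).symm

variable {f g}

theorem mk_mem_range_of_eventuallyNull {k : ℤ} {n m : ℕ} (h : (m : ℤ) = n + k)
    (γ : GenLoop (Fin m) (B.space n) (B.pt n))
    (hγ : (cyl f g).EventuallyNull ((cylLeft f g).mapLoop γ)) :
    (Quot.mk _ ⟨n, m, h, γ⟩ : StablePi B k) ∈ range (Hom.mapPi f k) := by
  generalize hβ : (cylLeft f g).mapLoop γ = β at hγ
  induction hγ with
  | null hβ_null =>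
    obtain ⟨δ, hδ⟩ := exists_homotopic_stab_of_cylLeft_null f g γ (hβ ▸ hβ_null)
    refine ⟨Quot.mk _ ⟨_, _, by push_cast; omega, δ⟩, ?_⟩
    exact (Quot.sound (StableRel.homotopy _ _ _ _ _ hδ)).trans
      (Quot.sound (StableRel.stab _ _ h γ)).symm
  | of_stab _ ih =>
    rw [Quot.sound (StableRel.stab _ _ h γ)]
    exact ih _ (B.stab γ) (congrArg (cyl f g).stab hβ)

theorem IsHomotopyPushout.mapPi_surjective {h : B ⟶ D} {l : C ⟶ D}
    (H : IsHomotopyPushout f g h l) (hD : D.WeaklyContractible) (k : ℤ) :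
    Function.Surjective (Hom.mapPi f k) := by
  obtain ⟨_, hcyl⟩ := H
  intro b
  induction b using Quot.ind with | mk r => ?_
  have := hD k
  exact mk_mem_range_of_eventuallyNull r.index r.loop
    (eventuallyNull_of_mk_eq_const (h := r.index) ((hcyl k).injective (Subsingleton.elim _ _)))

end Cylinder

/-! ### Weak contractibility and wedges -/

section WeaklyContractible

instance (A : TopSpectrum.{v}) (k : ℤ) : Nonempty (StablePi A k) :=
  ⟨Quot.mk _ ⟨k.natAbs, (k.natAbs + k).toNat, by omega, GenLoop.const⟩⟩

/-- The trivial map of spectra. -/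
def zeroHom (A : TopSpectrum.{v}) (B : TopSpectrum.{w}) : Hom A B where
  app n := ContinuousMap.const _ (B.pt n)
  app_pt _ := rfl
  app_adj n _ s := (B.adj_pt n s).symm

variable {A : TopSpectrum.{v}} {B : TopSpectrum.{w}}

theorem mapPi_zeroHom_eq (k : ℤ) (a a' : StablePi A k) :
    (zeroHom A B).mapPi k a = (zeroHom A B).mapPi k a' := by
  induction a using Quot.ind with | mk r => ?_
  induction a' using Quot.ind with | mk r' => ?_
  exact B.mk_const_eq r.index r'.index

theorem weaklyContractible_of_mapPi_zeroHom (h : ∀ k, (zeroHom A A).mapPi k = id) :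
    A.WeaklyContractible :=
  fun k => ⟨fun a a' => by simpa only [h k, id] using mapPi_zeroHom_eq (B := A) k a a'⟩

theorem weaklyContractible_of_subsingleton (h : ∀ n, Subsingleton (A.space n)) :
    A.WeaklyContractible := by
  refine weaklyContractible_of_mapPi_zeroHom fun k => ?_
  have e : zeroHom A A = 𝟙 A := Hom.ext (funext fun n => ContinuousMap.ext fun _ => (h n).elim _ _)
  rw [e, mapPi_id]

theorem WeaklyContractible.isWeakEquiv (hA : A.WeaklyContractible) (hB : B.WeaklyContractible)
    (f : Hom A B) : f.IsWeakEquiv := by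
  intro k
  have := hA k
  have := hB k
  exact ⟨Function.injective_of_subsingleton _,
    fun _ => ⟨Classical.arbitrary _, Subsingleton.elim _ _⟩⟩

variable {ι : Type u}

/-- The inclusion of a summand in a wedge of spectra. -/
def wedgeIncl (A : ι → TopSpectrum.{v}) (i : ι) : Hom (A i) (wedge A) where
  app n := wedgeIn A n i
  app_pt _ := Quot.sound (WedgeRel.base i)
  app_adj _ _ _ := rfl

theorem mapPi_wedgeDesc_comp_wedgeIncl {A : ι → TopSpectrum.{v}} (f : ∀ i, Hom (A i) B) (i : ι)
    (k : ℤ) : (wedgeDesc f).mapPi k ∘ (wedgeIncl A i).mapPi k = (f i).mapPi k :=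
  (Hom.mapPi_comp (wedgeIncl A i) (wedgeDesc f) k).symm

theorem wedgeDesc_comp {A : ι → TopSpectrum.{v}} {C : TopSpectrum.{w}} (f : ∀ i, Hom (A i) B)
    (h : Hom B C) : (wedgeDesc f).comp h = wedgeDesc fun i => (f i).comp h := by
  refine Hom.ext (funext fun n => ContinuousMap.ext fun x => ?_)
  induction x using Quot.ind with | mk a => ?_
  rcases a with _ | ⟨i, x⟩
  · exact h.app_pt n
  · rfl

theorem weaklyContractible_wedge_of_isEmpty [IsEmpty ι] (A : ι → TopSpectrum.{v}) :
    (wedge A).WeaklyContractible := by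
  refine weaklyContractible_of_subsingleton fun n => ⟨fun a b => ?_⟩
  induction a using Quot.ind with | mk a => ?_
  induction b using Quot.ind with | mk b => ?_
  rcases a with _ | ⟨i, -⟩
  · rcases b with _ | ⟨i, -⟩
    · rfl
    · exact (IsEmpty.false i).elim
  · exact (IsEmpty.false i).elim

/-- If the fold map is a weak equivalence, then the two inclusions in the wedge agree on `π_k`,
hence so do the two components `0` and `𝟙 A` of a map out of the wedge. -/
theorem weaklyContractible_of_isWeakEquiv_fold [Nontrivial ι]
    (h : Hom.IsWeakEquiv (wedgeDesc fun _ : ι => (𝟙 A : A ⟶ A))) : A.WeaklyContractible := by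
  classical
  obtain ⟨i, j, hij⟩ := exists_pair_ne ι
  refine weaklyContractible_of_mapPi_zeroHom fun k => ?_
  have hincl : (wedgeIncl (fun _ : ι => A) i).mapPi k = (wedgeIncl (fun _ : ι => A) j).mapPi k := by
    refine (h k).injective.comp_left ?_
    simp only [mapPi_wedgeDesc_comp_wedgeIncl]
  let f (l : ι) : Hom A A := if l = i then zeroHom A A else 𝟙 A
  calc (zeroHom A A).mapPi k = (wedgeDesc f).mapPi k ∘ (wedgeIncl (fun _ => A) i).mapPi k := by
        rw [mapPi_wedgeDesc_comp_wedgeIncl, show f i = zeroHom A A from if_pos rfl]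
    _ = (wedgeDesc f).mapPi k ∘ (wedgeIncl (fun _ => A) j).mapPi k := by rw [hincl]
    _ = id := by
        rw [mapPi_wedgeDesc_comp_wedgeIncl, show f j = 𝟙 A from if_neg hij.symm, mapPi_id]

end WeaklyContractible

end TopSpectrum

/-! ### Coarse structures and generalised rays -/

namespace CoarseStructure

section Bounded

variable {X : Type u} {Y : Type v} {s : CoarseStructure X} {t : CoarseStructure Y}

theorem bounded_iff_prod {B : Set X} : s.Bounded B ↔ s.Controlled (B ×ˢ B) :=
  ⟨fun h => h.prod h, bounded_of_prod⟩

theorem controlled_empty : s.Controlled ∅ :=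
  s.subset s.diag (empty_subset _)

theorem controlled_biUnion {ι : Type w} {T : Set ι} (hT : T.Finite) {M : ι → Set (X × X)}
    (hM : ∀ i ∈ T, s.Controlled (M i)) : s.Controlled (⋃ i ∈ T, M i) := by
  induction T, hT using Set.Finite.induction_on with
  | empty => simpa only [biUnion_empty] using s.controlled_empty
  | insert _ _ ih =>
    rw [biUnion_insert]
    exact s.union (hM _ (mem_insert _ _)) (ih fun i hi => hM i (mem_insert_of_mem _ hi))

theorem Bounded.relImage {B : Set X} (hB : s.Bounded B) {M : Set (X × X)} (hM : s.Controlled M) :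
    s.Bounded (relImage M B) := by
  refine bounded_iff_prod.2 (s.subset (s.comp (s.comp (s.symm hM) (hB.prod hB)) hM) ?_)
  rintro ⟨y, y'⟩ ⟨⟨x, hx, hxy⟩, x', hx', hxy'⟩
  exact ⟨x', ⟨x, hxy, hx, hx'⟩, hxy'⟩

theorem prod_controlled_iff {M : Set ((X × Y) × (X × Y))} :
    (s.prod t).Controlled M ↔ s.Controlled ((fun p => (p.1.1, p.2.1)) '' M) ∧
      t.Controlled ((fun p => (p.1.2, p.2.2)) '' M) := by
  constructor
  · rintro ⟨M₁, M₂, h₁, h₂, h⟩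
    refine ⟨s.subset h₁ ?_, t.subset h₂ ?_⟩
    · rintro _ ⟨p, hp, rfl⟩
      exact (h p hp).1
    · rintro _ ⟨p, hp, rfl⟩
      exact (h p hp).2
  · rintro ⟨h₁, h₂⟩
    exact ⟨_, _, h₁, h₂, fun p hp => ⟨⟨p, hp, rfl⟩, ⟨p, hp, rfl⟩⟩⟩

theorem prod_bounded_iff {B : Set (X × Y)} :
    (s.prod t).Bounded B ↔ s.Bounded (Prod.fst '' B) ∧ t.Bounded (Prod.snd '' B) := by
  rw [bounded_iff_prod, bounded_iff_prod, bounded_iff_prod, prod_controlled_iff,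
    prod_image_image_eq, prod_image_image_eq]

theorem sub_bounded_iff {A : Set X} {B : Set A} :
    (s.sub A).Bounded B ↔ s.Bounded (Subtype.val '' B) := by
  rw [bounded_iff_prod, bounded_iff_prod, ← prodMap_image_prod]
  rfl

theorem sub_prod_controlled_iff {A : Set (X × Y)} {M : Set (A × A)} :
    ((s.prod t).sub A).Controlled M ↔ s.Controlled ((fun p => (p.1.1.1, p.2.1.1)) '' M) ∧
      t.Controlled ((fun p => (p.1.1.2, p.2.1.2)) '' M) := by
  refine prod_controlled_iff.trans ?_
  rw [image_image, image_image]
  rfl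

theorem sub_prod_bounded_iff {A : Set (X × Y)} {B : Set A} :
    ((s.prod t).sub A).Bounded B ↔
      s.Bounded ((fun q => q.1.1) '' B) ∧ t.Bounded ((fun q => q.1.2) '' B) := by
  rw [sub_bounded_iff, prod_bounded_iff, image_image, image_image]

theorem _root_.IsCoarseMap.comp {Z : Type w} {s : CoarseStructure X} {t : CoarseStructure Y}
    {r : CoarseStructure Z} {g : Y → Z} {f : X → Y} (hg : IsCoarseMap t r g)
    (hf : IsCoarseMap s t f) : IsCoarseMap s r (g ∘ f) where
  controlled M hM := by
    rw [← Prod.map_comp_map, image_comp]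
    exact hg.controlled _ (hf.controlled M hM)
  proper B hB := hf.proper _ (hg.proper B hB)

theorem _root_.IsCoarseMap.bounded_image {f : X → Y} (hf : IsCoarseMap s t f) {B : Set X}
    (hB : s.Bounded B) : t.Bounded (f '' B) := by
  rw [bounded_iff_prod, ← prodMap_image_prod]
  exact hf.controlled _ (hB.prod hB)

end Bounded

section Metric

variable (X : Type u) [PseudoMetricSpace X]

/-- The bounded coarse structure of a metric space: a set of pairs is controlled if the distances
of its pairs are uniformly bounded. -/
def ofMetric : CoarseStructure X where
  Controlled M := ∃ C, ∀ p ∈ M, dist p.1 p.2 ≤ C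
  union := by
    rintro M N ⟨C, hC⟩ ⟨D, hD⟩
    exact ⟨max C D, fun p hp => hp.elim (fun h => le_max_of_le_left (hC p h))
      fun h => le_max_of_le_right (hD p h)⟩
  subset := fun ⟨C, hC⟩ h => ⟨C, fun p hp => hC p (h hp)⟩
  symm := fun ⟨C, hC⟩ => ⟨C, fun p hp => dist_comm p.1 p.2 ▸ hC _ hp⟩
  comp := by
    rintro M N ⟨C, hC⟩ ⟨D, hD⟩
    exact ⟨C + D, fun p ⟨y, hy, hy'⟩ =>
      (dist_triangle p.1 y p.2).trans (add_le_add (hC _ hy) (hD _ hy'))⟩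
  diag := ⟨0, fun p (hp : p.1 = p.2) => (congrArg (dist p.1) hp.symm).trans_le (dist_self _).le⟩
  connected x y := ⟨{(x, y)}, ⟨dist x y, by rintro _ rfl; exact le_rfl⟩, rfl⟩

variable {X}

theorem ofMetric_bounded_iff {B : Set X} :
    (ofMetric X).Bounded B ↔ Bornology.IsBounded B := by
  rw [bounded_iff_prod, Metric.isBounded_iff]
  exact exists_congr fun C => ⟨fun h x hx y hy => h (x, y) ⟨hx, hy⟩, fun h p hp => h hp.1 hp.2⟩

theorem CompatibleWithTopology.of_ofMetric_le [ProperSpace X] {s : CoarseStructure X}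
    (hs : ∀ M, (ofMetric X).Controlled M → s.Controlled M)
    (hb : ∀ B, s.Bounded B → Bornology.IsBounded B) : s.CompatibleWithTopology := by
  refine ⟨fun M hM => ⟨⋃ p ∈ M, Metric.ball p.1 1 ×ˢ Metric.ball p.2 1, ?_, ?_, fun p hp =>
    mem_biUnion hp ⟨Metric.mem_ball_self one_pos, Metric.mem_ball_self one_pos⟩⟩,
    fun B hB => (hb B hB).isCompact_closure⟩
  · have hU : s.Controlled {p | dist p.1 p.2 ≤ 1} := hs _ ⟨1, fun p hp => hp⟩
    refine s.subset (s.comp (s.comp hU hM) hU) (iUnion₂_subset fun p hp q hq => ?_)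
    exact ⟨p.2, ⟨p.1, (Metric.mem_ball.1 hq.1).le, hp⟩, (Metric.mem_ball'.1 hq.2).le⟩
  · exact isOpen_biUnion fun p _ => Metric.isOpen_ball.prod Metric.isOpen_ball

end Metric

section Bornology

variable (X : Type u) [Bornology X]

/-- The largest coarse structure with the given bounded sets: a relation is controlled if it and
its inverse send bounded sets to bounded sets. -/
def ofBornology : CoarseStructure X where
  Controlled M := ∀ B, Bornology.IsBounded B →
    Bornology.IsBounded (relImage M B) ∧ Bornology.IsBounded (relImage (Prod.swap ⁻¹' M) B)
  union := by
    refine fun hM hN B hB => ⟨((hM B hB).1.union (hN B hB).1).subset ?_,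
      ((hM B hB).2.union (hN B hB).2).subset ?_⟩ <;>
    · rintro y ⟨x, hx, h | h⟩
      · exact Or.inl ⟨x, hx, h⟩
      · exact Or.inr ⟨x, hx, h⟩
  subset := fun hN h B hB => ⟨(hN B hB).1.subset fun _ ⟨x, hx, hxy⟩ => ⟨x, hx, h hxy⟩,
    (hN B hB).2.subset fun _ ⟨x, hx, hxy⟩ => ⟨x, hx, h hxy⟩⟩
  symm := fun hM B hB => (hM B hB).symm
  comp := fun hM hN B hB =>
    ⟨(hN _ (hM B hB).1).1.subset fun _ ⟨x, hx, y, hxy, hyz⟩ => ⟨y, ⟨x, hx, hxy⟩, hyz⟩,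
      (hM _ (hN B hB).2).2.subset fun _ ⟨x, hx, y, hxy, hyz⟩ => ⟨y, ⟨x, hx, hyz⟩, hxy⟩⟩
  diag := fun B hB => ⟨hB.subset fun y ⟨x, hx, h⟩ => mem_of_eq_of_mem (Eq.symm (a := x) h) hx,
    hB.subset fun y ⟨x, hx, h⟩ => mem_of_eq_of_mem (x := y) h hx⟩
  connected x y := ⟨{(x, y)}, fun _ _ =>
    ⟨Bornology.isBounded_singleton.subset fun _ ⟨_, _, h⟩ => congrArg Prod.snd h,
      Bornology.isBounded_singleton.subset fun _ ⟨_, _, h⟩ => congrArg Prod.fst h⟩, rfl⟩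

variable {X}

theorem ofBornology_bounded_iff {B : Set X} :
    (ofBornology X).Bounded B ↔ Bornology.IsBounded B := by
  constructor
  · rintro (rfl | ⟨x, hx⟩)
    · exact Bornology.isBounded_empty
    · exact (hx {x} Bornology.isBounded_singleton).2.subset fun b hb => ⟨x, rfl, hb, rfl⟩
  · exact fun hB => bounded_iff_prod.2 fun _ _ =>
      ⟨hB.subset fun _ ⟨_, _, h⟩ => h.2, hB.subset fun _ ⟨_, _, h⟩ => h.1⟩

theorem isCoarseMap_ofBornology_iff {Y : Type v} {s : CoarseStructure Y} {f : Y → X} :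
    IsCoarseMap s (ofBornology X) f ↔ (∀ B, s.Bounded B → Bornology.IsBounded (f '' B)) ∧
      ∀ B, Bornology.IsBounded B → s.Bounded (f ⁻¹' B) := by
  refine ⟨fun hf => ⟨fun B hB => ofBornology_bounded_iff.1 (hf.bounded_image hB),
    fun B hB => hf.proper B (ofBornology_bounded_iff.2 hB)⟩,
    fun hf => ⟨fun M hM B hB => ⟨?_, ?_⟩, fun B hB => hf.2 B (ofBornology_bounded_iff.1 hB)⟩⟩
  · refine (hf.1 _ ((hf.2 B hB).relImage hM)).subset ?_
    rintro _ ⟨_, hx, p, hp, h⟩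
    cases h
    exact ⟨p.2, ⟨p.1, hx, hp⟩, rfl⟩
  · refine (hf.1 _ ((hf.2 B hB).relImage (s.symm hM))).subset ?_
    rintro _ ⟨_, hx, p, hp, h⟩
    cases h
    exact ⟨p.1, ⟨p.2, hx, hp⟩, rfl⟩

theorem ofBornology_nnreal_controlled_iff {M : Set (ℝ≥0 × ℝ≥0)} :
    (ofBornology ℝ≥0).Controlled M ↔
      ∀ n, ∃ m, ∀ p ∈ M, (p.1 ≤ n → p.2 ≤ m) ∧ (p.2 ≤ n → p.1 ≤ m) := by
  constructor
  · intro hM n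
    obtain ⟨h₁, h₂⟩ := hM (Iic n) (isCompact_Icc.isBounded.subset fun _ h => ⟨bot_le, h⟩)
    obtain ⟨⟨a, ha⟩, b, hb⟩ := And.intro h₁.bddAbove h₂.bddAbove
    exact ⟨max a b, fun p hp => ⟨fun h => le_max_of_le_left (ha ⟨p.1, h, hp⟩),
      fun h => le_max_of_le_right (hb ⟨p.2, h, hp⟩)⟩⟩
  · intro hM B hB
    obtain ⟨n, hn⟩ := hB.bddAbove
    obtain ⟨m, hm⟩ := hM n
    exact ⟨(OrderBot.bddBelow _).isBounded ⟨m, fun _ ⟨x, hx, h⟩ => (hm _ h).1 (hn hx)⟩,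
      (OrderBot.bddBelow _).isBounded ⟨m, fun _ ⟨x, hx, h⟩ => (hm _ h).2 (hn hx)⟩⟩

end Bornology

end CoarseStructure

namespace CoarseSpace

open CoarseStructure

theorem IsGeneralisedRay.of_add_between {r : CoarseStructure ℝ≥0}
    (compatible : r.CompatibleWithTopology)
    (add : ∀ M N, r.Controlled M → r.Controlled N →
      r.Controlled {q | ∃ m ∈ M, ∃ n ∈ N, q = (m.1 + n.1, m.2 + n.2)})
    (between : ∀ M, r.Controlled M →
      r.Controlled {q | ∃ m ∈ M, m.1 ≤ q.1 ∧ q.1 ≤ m.2 ∧ m.1 ≤ q.2 ∧ q.2 ≤ m.2}) :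
    IsGeneralisedRay r where
  compatible := compatible
  add := add
  between := between
  translate M hM a := r.subset (add _ M r.diag hM) fun _ ⟨m, hm, h⟩ => ⟨(a, a), rfl, m, hm, h⟩

theorem isGeneralisedRay_ofMetric : IsGeneralisedRay (ofMetric ℝ≥0) := by
  refine .of_add_between
    (.of_ofMetric_le (fun _ h => h) fun _ => ofMetric_bounded_iff.1) ?_ ?_
  · rintro M N ⟨C, hC⟩ ⟨D, hD⟩
    refine ⟨C + D, ?_⟩
    rintro _ ⟨m, hm, n, hn, rfl⟩
    have h := dist_add_add_le (m.1 : ℝ) n.1 m.2 n.2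
    exact h.trans (add_le_add (hC m hm) (hD n hn))
  · rintro M ⟨C, hC⟩
    refine ⟨C, ?_⟩
    rintro q ⟨m, hm, h₁, h₂, h₃, h₄⟩
    exact (Real.dist_le_of_mem_Icc ⟨h₁, h₂⟩ ⟨h₃, h₄⟩).trans
      ((le_abs_self _).trans ((Real.dist_eq _ _).ge.trans ((dist_comm _ _).trans_le (hC m hm))))

theorem isGeneralisedRay_ofBornology : IsGeneralisedRay (ofBornology ℝ≥0) := by
  refine .of_add_between
    (.of_ofMetric_le ?_ fun _ => ofBornology_bounded_iff.1) ?_ ?_ <;>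
    simp only [ofBornology_nnreal_controlled_iff]
  · rintro M ⟨C, hC⟩ n
    refine ⟨n + C.toNNReal, fun p hp => ?_⟩
    have h := (abs_le.1 ((NNReal.dist_eq _ _).ge.trans ((hC p hp).trans (Real.le_coe_toNNReal C))))
    constructor <;> intro hn <;> rw [← NNReal.coe_le_coe] at hn ⊢ <;> push_cast <;> linarith
  · intro M N hM hN k
    obtain ⟨a, ha⟩ := hM k
    obtain ⟨b, hb⟩ := hN k
    refine ⟨a + b, ?_⟩
    rintro _ ⟨m, hm, n, hn, rfl⟩
    exact ⟨fun h => add_le_add ((ha m hm).1 (le_self_add.trans h))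
        ((hb n hn).1 (le_add_self.trans h)),
      fun h => add_le_add ((ha m hm).2 (le_self_add.trans h))
        ((hb n hn).2 (le_add_self.trans h))⟩
  · intro M hM k
    obtain ⟨a, ha⟩ := hM k
    refine ⟨a, ?_⟩
    rintro q ⟨m, hm, h₁, h₂, h₃, h₄⟩
    exact ⟨fun h => h₄.trans ((ha m hm).1 (h₁.trans h)),
      fun h => h₂.trans ((ha m hm).1 (h₃.trans h))⟩

theorem IsGeneralisedRay.bounded_iff {r : CoarseStructure ℝ≥0} (hr : IsGeneralisedRay r)
    {B : Set ℝ≥0} : r.Bounded B ↔ Bornology.IsBounded B := by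
  refine ⟨fun hB => (hr.compatible.2 B hB).isBounded.subset subset_closure, fun hB => ?_⟩
  obtain ⟨n, hn⟩ := hB.bddAbove
  obtain ⟨M, hM, h0n⟩ := r.connected 0 n
  exact bounded_of_prod (r.subset (hr.between M hM) fun q hq =>
    ⟨(0, n), h0n, bot_le, hn hq.1, bot_le, hn hq.2⟩)

theorem IsGeneralisedRay.isCoarseMap_fst_subgraph {X : Type u} {s : CoarseStructure X}
    {r : CoarseStructure ℝ≥0} (hr : IsGeneralisedRay r) {f : X → ℝ≥0}
    (hf : ∀ B, s.Bounded B → Bornology.IsBounded (f '' B)) :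
    IsCoarseMap ((s.prod r).sub {q | q.2 ≤ f q.1}) s fun q => q.1.1 where
  controlled M hM := by
    have h := (prod_controlled_iff.1 hM).1
    rwa [image_image] at h
  proper B hB := by
    refine sub_bounded_iff.2 (prod_bounded_iff.2 ⟨hB.mono ?_, hr.bounded_iff.2 ?_⟩)
    · rintro _ ⟨_, ⟨q, hq, rfl⟩, rfl⟩
      exact hq
    · obtain ⟨n, hn⟩ := (hf B hB).bddAbove
      refine (OrderBot.bddBelow _).isBounded ⟨n, ?_⟩
      rintro _ ⟨_, ⟨q, hq, rfl⟩, rfl⟩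
      exact q.2.trans (hn (mem_image_of_mem f hq))

theorem IsGeneralisedRay.isCoarseMap_fst_cylinder {X : CoarseSpace.{u}} {r : CoarseStructure ℝ≥0}
    (hr : IsGeneralisedRay r) {p : X.carrier → ℝ≥0} (hp : IsCoarseMap X.str r p) :
    IsCoarseMap (X.cylinder r p).str X.str fun q => q.1.1 := by
  refine hr.isCoarseMap_fst_subgraph (f := fun x => p x + 1) fun B hB => ?_
  obtain ⟨n, hn⟩ := (hr.bounded_iff.1 (hp.bounded_image hB)).bddAbove
  refine (OrderBot.bddBelow _).isBounded ⟨n + 1, ?_⟩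
  rintro _ ⟨x, hx, rfl⟩
  exact add_le_add_left (hn (mem_image_of_mem p hx)) 1

theorem _root_.IsCoarseMap.of_close {X : Type u} {Y : Type v} {s : CoarseStructure X}
    {t : CoarseStructure Y} {f g : X → Y} (hf : IsCoarseMap s t f) (h : t.Close f g) :
    IsCoarseMap s t g where
  controlled M hM := by
    refine t.subset (t.comp (t.comp (t.symm h) (hf.controlled M hM)) h) ?_
    rintro _ ⟨p, hp, rfl⟩
    exact ⟨f p.2, ⟨f p.1, ⟨p.1, rfl⟩, p, hp, rfl⟩, p.2, rfl⟩
  proper B hB := (hf.proper _ (hB.relImage (t.symm h))).mono fun x hx => ⟨g x, hx, x, rfl⟩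

theorem elementaryHomotopic_of_close {X Y : CoarseSpace.{u}} {f₀ f₁ : X ⟶ Y}
    (h : Y.str.Close f₀.toFun f₁.toFun) {r : CoarseStructure ℝ≥0} (hr : IsGeneralisedRay r)
    {p : X.carrier → ℝ≥0} (hp : IsCoarseMap X.str r p) : ElementaryHomotopic f₀ f₁ := by
  classical
  let π : X.cylinder r p ⟶ X := ⟨_, hr.isCoarseMap_fst_cylinder hp⟩
  let H : (X.cylinder r p).carrier → Y.carrier := fun q =>
    if q.1.2 = 0 then f₀.toFun q.1.1 else f₁.toFun q.1.1
  have hH : Y.str.Close (π ≫ f₀).toFun H := by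
    refine Y.str.subset (Y.str.union Y.str.diag h) ?_
    rintro _ ⟨q, rfl⟩
    by_cases hq : q.1.2 = 0
    · exact Or.inl (if_pos hq).symm
    · exact Or.inr ⟨q.1.1, Prod.ext rfl (if_neg hq).symm⟩
  exact ⟨r, p, hr, hp, ⟨H, (π ≫ f₀).isCoarse.of_close hH⟩, fun x => (if_pos rfl).symm,
    fun x => (if_neg (by simp)).symm⟩

theorem isCoarseHomotopyEquiv_of_surjective {X Y : CoarseSpace.{u}} {f : X ⟶ Y}
    (hf : Function.Surjective f.toFun)
    (hf_reflects : ∀ M, Y.str.Controlled (Prod.map f.toFun f.toFun '' M) → X.str.Controlled M)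
    {r : CoarseStructure ℝ≥0} (hr : IsGeneralisedRay r) {p : X.carrier → ℝ≥0}
    (hp : IsCoarseMap X.str r p) : IsCoarseHomotopyEquiv f := by
  have hfg := Function.rightInverse_surjInv hf
  let g : Y ⟶ X := ⟨Function.surjInv hf, fun M hM => hf_reflects _ <| by
      rwa [← image_comp, Prod.map_comp_map, hfg.id, Prod.map_id, image_id],
    fun B hB => (f.isCoarse.bounded_image hB).mono fun y hy => ⟨_, hy, hfg y⟩⟩
  have hgf : X.str.Close (f ≫ g).toFun (𝟙 X : X ⟶ X).toFun := by
    refine hf_reflects _ (Y.str.subset Y.str.diag ?_)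
    rintro _ ⟨_, ⟨x, rfl⟩, rfl⟩
    exact hfg (f.toFun x)
  have hfg' : g ≫ f = 𝟙 Y := Hom.ext (funext hfg)
  exact ⟨g, .rel _ _ (elementaryHomotopic_of_close hgf hr hp), hfg' ▸ .refl _⟩

/-- The product of a coarse space with the ray `[0, ∞)` carrying its metric coarse structure. -/
abbrev prodRay (X : CoarseSpace.{u}) : CoarseSpace.{u} :=
  ⟨X.carrier × ℝ≥0, X.str.prod (ofMetric ℝ≥0)⟩

theorem flasque_prodRay (X : CoarseSpace.{u}) : X.prodRay.Flasque := by
  let t : X.carrier × ℝ≥0 → X.carrier × ℝ≥0 := Prod.map id (· + 1)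
  have ht (n : ℕ) : t^[n] = Prod.map id (· + (n : ℝ≥0)) := by
    simp only [t, Prod.map_iterate, Function.iterate_id, add_right_iterate, nsmul_one]
  refine ⟨t, fun B hB => ?_, fun M hM => ?_, prod_controlled_iff.2 ⟨?_, 1, ?_⟩⟩
  · obtain ⟨n, hn⟩ := (ofMetric_bounded_iff.1 (prod_bounded_iff.1 hB).2).bddAbove
    obtain ⟨N, hN⟩ := exists_nat_gt n
    refine ⟨N, fun k hk => eq_empty_of_forall_notMem ?_⟩
    rintro _ ⟨⟨q, rfl⟩, hq⟩
    rw [ht] at hq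
    have hkn : q.2 + k ≤ n := hn ⟨_, hq, rfl⟩
    exact hN.not_ge ((Nat.cast_le.2 hk).trans (le_add_self.trans hkn))
  · obtain ⟨h, C, hC⟩ := prod_controlled_iff.1 hM
    simp only [ht]
    refine prod_controlled_iff.2 ⟨X.str.subset h ?_, C, ?_⟩
    · rintro _ ⟨_, hp', rfl⟩
      obtain ⟨n, p, hp, rfl⟩ := mem_iUnion.1 hp'
      exact ⟨p, hp, rfl⟩
    · rintro _ ⟨_, hp', rfl⟩
      obtain ⟨n, p, hp, rfl⟩ := mem_iUnion.1 hp'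
      exact (dist_add_right (p.1.2 : ℝ) p.2.2 n).trans_le (hC _ ⟨p, hp, rfl⟩)
  · refine X.str.subset X.str.diag ?_
    rintro _ ⟨_, ⟨q, rfl⟩, rfl⟩
    rfl
  · rintro _ ⟨_, ⟨q, rfl⟩, rfl⟩
    exact (dist_self_add_left (1 : ℝ) q.2).trans_le norm_one.le

end CoarseSpace

/-! ### The continuously controlled open cone -/

namespace Cone

variable {X : Type u}

variable (X) in
/-- The apex of the cone. -/
def apex : Cone X := Quot.mk _ (Sum.inl PUnit.unit)

theorem mk_zero (x : X) : mk x 0 = apex X := Quot.sound (ConeRel.apex x)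

theorem eq_apex_or_eq_mk (c : Cone X) : c = apex X ∨ ∃ x, ∃ t ≠ 0, c = mk x t := by
  induction c using Quot.ind with | mk p
  rcases p with _ | ⟨x, t⟩
  · exact Or.inl rfl
  · rcases eq_or_ne t 0 with rfl | ht
    · exact Or.inl (mk_zero x)
    · exact Or.inr ⟨x, t, ht, rfl⟩

theorem exists_eq_mk_of_height_ne_zero {c : Cone X} (h : c.height ≠ 0) :
    ∃ x, c = mk x c.height := by
  rcases eq_apex_or_eq_mk c with rfl | ⟨x, t, -, rfl⟩
  · exact absurd rfl h
  · exact ⟨x, rfl⟩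

theorem eq_of_mk_eq_mk {x y : X} {s t : I} (h : mk x s = mk y t) (hs : s ≠ 0) : x = y := by
  have hx : mk y t ∈ Cone.over {x} := h ▸ ⟨rfl, unitInterval.pos_iff_ne_zero.2 hs⟩
  exact hx.1.symm

variable [TopologicalSpace X]

theorem continuous_mk : Continuous fun p : X × I => mk p.1 p.2 :=
  continuous_quot_mk.comp continuous_inr

theorem isClosed_image_mk [CompactSpace X] [T2Space X] {K : Set X} (hK : IsClosed K) :
    IsClosed ((fun p : X × I => mk p.1 p.2) '' K ×ˢ univ) :=
  ((hK.isCompact.prod isCompact_univ).image continuous_mk).isClosed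

end Cone

namespace OpenCone

variable {X : Type u} {Y : Type v}

/-- The distance to the apex: the radial coordinate of the open cone, rescaled from `[0, 1)` to
`[0, ∞)`. -/
noncomputable def level (c : OpenCone X) : ℝ≥0 :=
  ⟨c.1.height / (1 - c.1.height), div_nonneg c.1.height.2.1 (sub_nonneg.2 c.1.height.2.2)⟩

/-- The inverse of the rescaling that defines `OpenCone.level`. -/
noncomputable def heightOfLevel (r : ℝ≥0) : I :=
  ⟨r / (r + 1), by positivity, div_le_one_of_le₀ (by simp) (by positivity)⟩

theorem heightOfLevel_lt_one (r : ℝ≥0) : heightOfLevel r < 1 :=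
  (div_lt_one (by positivity : (0 : ℝ) < r + 1)).2 (lt_add_one (r : ℝ))

theorem heightOfLevel_zero : heightOfLevel 0 = 0 :=
  Subtype.ext (by simp [heightOfLevel])

theorem strictMono_heightOfLevel : StrictMono heightOfLevel := fun r s hrs => by
  exact (div_lt_div_iff₀ (by positivity : (0 : ℝ) < r + 1) (by positivity : (0 : ℝ) < s + 1)).2
    (by linarith [NNReal.coe_lt_coe.2 hrs])

theorem heightOfLevel_level (c : OpenCone X) : heightOfLevel (level c) = c.1.height := by
  have hc : (c.1.height : ℝ) < 1 := c.2
  have hc' : (1 - c.1.height : ℝ) ≠ 0 := (sub_pos.2 hc).ne'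
  refine Subtype.ext ?_
  change (c.1.height / (1 - c.1.height) : ℝ) / (c.1.height / (1 - c.1.height) + 1) = c.1.height
  field_simp
  ring

theorem level_le_iff {c : OpenCone X} {n : ℝ≥0} :
    level c ≤ n ↔ c.1.height ≤ heightOfLevel n := by
  rw [← heightOfLevel_level, strictMono_heightOfLevel.le_iff_le]

theorem level_eq_iff {c : OpenCone X} {n : ℝ≥0} :
    level c = n ↔ c.1.height = heightOfLevel n := by
  rw [← heightOfLevel_level, strictMono_heightOfLevel.injective.eq_iff]

theorem level_eq_zero_iff {c : OpenCone X} : level c = 0 ↔ c.1.height = 0 := by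
  rw [level_eq_iff, heightOfLevel_zero]

theorem level_eq_level_iff {c : OpenCone X} {d : OpenCone Y} :
    level c = level d ↔ c.1.height = d.1.height := by
  rw [level_eq_iff, heightOfLevel_level]

theorem exists_heightOfLevel_eq {t : I} (ht : t < 1) : ∃ n, heightOfLevel n = t :=
  ⟨_, heightOfLevel_level (⟨Cone.mk () t, ht⟩ : OpenCone Unit)⟩

theorem exists_level_le_of_isCompact [TopologicalSpace X] {T : Set (Cone X)} (hT : IsCompact T)
    (h : ∀ c ∈ T, c.height ≠ 1) : ∃ n, ∀ c : OpenCone X, c.1 ∈ T → level c ≤ n := by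
  rcases T.eq_empty_or_nonempty with rfl | hne
  · exact ⟨0, fun c hc => hc.elim⟩
  obtain ⟨d, hd, hmax⟩ := hT.exists_isMaxOn hne Cone.continuous_height.continuousOn
  obtain ⟨n, hn⟩ := exists_heightOfLevel_eq (unitInterval.lt_one_iff_ne_one.2 (h d hd))
  exact ⟨n, fun c hc => level_le_iff.2 (hn ▸ hmax hc)⟩

end OpenCone

namespace continuouslyControlled

open CoarseStructure OpenCone

variable {X : Type u} [TopologicalSpace X] {M : Set (OpenCone X × OpenCone X)}

theorem eq_one_of_mem_closure {Z : Type w} [TopologicalSpace Z] {S : Set Z} {f g : Z → I}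
    (hf : Continuous f) (hg : Continuous g)
    (h : ∀ t < 1, ∃ t' < 1, ∀ z ∈ S, g z ≤ t → f z ≤ t') {z : Z} (hz : z ∈ closure S)
    (hfz : f z = 1) : g z = 1 := by
  by_contra hgz
  obtain ⟨t, hgt, ht⟩ := exists_between (unitInterval.lt_one_iff_ne_one.2 hgz)
  obtain ⟨t', ht', hS⟩ := h t ht
  have hz' : z ∈ closure (g ⁻¹' Iio t ∩ S) :=
    (isOpen_Iio.preimage hg).inter_closure ⟨hgt, hz⟩
  have hfz' : f z ≤ t' :=
    closure_minimal (fun y hy => hS y hy.2 (le_of_lt hy.1)) (isClosed_Iic.preimage hf) hz'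
  exact (hfz'.trans_lt ht').ne hfz

theorem height_eq_one_of_mem_closure
    (hM : (ofBornology ℝ≥0).Controlled (Prod.map level level '' M)) {p : Cone X × Cone X}
    (hp : p ∈ closure (lift M)) (hp₁ : p.1.height = 1 ∨ p.2.height = 1) :
    p.1.height = 1 ∧ p.2.height = 1 := by
  have hcont₁ : Continuous fun p : Cone X × Cone X => p.1.height :=
    Cone.continuous_height.comp continuous_fst
  have hcont₂ : Continuous fun p : Cone X × Cone X => p.2.height :=
    Cone.continuous_height.comp continuous_snd
  have hM' (t : I) (ht : t < 1) : ∃ t' < 1, ∀ q ∈ lift M,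
      (q.1.height ≤ t → q.2.height ≤ t') ∧ (q.2.height ≤ t → q.1.height ≤ t') := by
    obtain ⟨n, rfl⟩ := exists_heightOfLevel_eq ht
    obtain ⟨m, hm⟩ := ofBornology_nnreal_controlled_iff.1 hM n
    refine ⟨_, heightOfLevel_lt_one m, ?_⟩
    rintro _ ⟨q, hq, rfl⟩
    simpa only [Prod.map_fst, Prod.map_snd, level_le_iff] using hm _ (mem_image_of_mem _ hq)
  rcases hp₁ with h | h
  · refine ⟨h, eq_one_of_mem_closure hcont₁ hcont₂ (fun t ht => ?_) hp h⟩
    exact (hM' t ht).imp fun _ h => ⟨h.1, fun q hq => (h.2 q hq).2⟩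
  · refine ⟨eq_one_of_mem_closure hcont₂ hcont₁ (fun t ht => ?_) hp h, h⟩
    exact (hM' t ht).imp fun _ h => ⟨h.1, fun q hq => (h.2 q hq).1⟩

variable [CompactSpace X] [T2Space X]

theorem bounded_iff {B : Set (OpenCone X)} :
    (continuouslyControlled X).Bounded B ↔ ∃ n, ∀ c ∈ B, level c ≤ n := by
  constructor
  · rintro (rfl | ⟨x, hx⟩)
    · exact ⟨0, fun c hc => hc.elim⟩
    · obtain ⟨n, hn⟩ := exists_level_le_of_isCompact
        ((isClosed_closure (s := lift (B ×ˢ {x}))).isCompact.image continuous_fst) (by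
          rintro _ ⟨p, hp, rfl⟩ h
          have hp₂ : p.2 = x.1 :=
            closure_minimal (t := {p : Cone X × Cone X | p.2 = x.1})
              (by rintro _ ⟨q, hq, rfl⟩; exact congrArg Subtype.val hq.2)
              (isClosed_eq continuous_snd continuous_const) hp
          exact x.2.ne (by rw [← hp₂, ← hx p hp (Or.inl h), h]))
      exact ⟨n, fun c hc => hn c ⟨_, subset_closure ⟨(c, x), ⟨hc, rfl⟩, rfl⟩, rfl⟩⟩
  · rintro ⟨n, hn⟩
    refine bounded_iff_prod.2 fun p hp hp₁ => ?_
    have hp' : p.1.height ≤ heightOfLevel n ∧ p.2.height ≤ heightOfLevel n :=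
      closure_minimal (t := Prod.map Cone.height Cone.height ⁻¹'
          Iic (heightOfLevel n) ×ˢ Iic (heightOfLevel n))
        (by rintro _ ⟨q, hq, rfl⟩; exact ⟨level_le_iff.1 (hn _ hq.1), level_le_iff.1 (hn _ hq.2)⟩)
        ((isClosed_Iic.prod isClosed_Iic).preimage
          (Cone.continuous_height.prodMap Cone.continuous_height)) hp
    have hn₁ := heightOfLevel_lt_one n
    exact (hp₁.elim (hp'.1.trans_lt hn₁).ne (hp'.2.trans_lt hn₁).ne).elim

theorem isCoarseMap_level :
    IsCoarseMap (continuouslyControlled X) (ofBornology ℝ≥0) level := by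
  refine isCoarseMap_ofBornology_iff.2 ⟨fun B hB => ?_, fun B hB => ?_⟩
  · obtain ⟨n, hn⟩ := bounded_iff.1 hB
    exact (OrderBot.bddBelow _).isBounded ⟨n, forall_mem_image.2 hn⟩
  · obtain ⟨n, hn⟩ := hB.bddAbove
    exact bounded_iff.2 ⟨n, fun c hc => hn hc⟩

theorem exists_level_le (hM : (continuouslyControlled X).Controlled M) (n : ℝ≥0) :
    ∃ m, ∀ p ∈ M, level p.1 ≤ n → level p.2 ≤ m := by
  obtain ⟨m, hm⟩ := ofBornology_nnreal_controlled_iff.1 (isCoarseMap_level.controlled M hM) n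
  exact ⟨m, fun p hp => (hm _ (mem_image_of_mem _ hp)).1⟩

theorem controlled_of_sameRay
    (hM : (ofBornology ℝ≥0).Controlled (Prod.map level level '' M))
    (hray : ∀ p ∈ M, ∃ x, p.1.1 = Cone.mk x p.1.1.height ∧ p.2.1 = Cone.mk x p.2.1.height) :
    (continuouslyControlled X).Controlled M := by
  intro p hp hp₁
  obtain ⟨h₁, h₂⟩ := height_eq_one_of_mem_closure hM hp hp₁
  have hcont : Continuous fun q : X × I × I => (Cone.mk q.1 q.2.1, Cone.mk q.1 q.2.2) :=
    (Cone.continuous_mk.comp (continuous_fst.prodMk (continuous_fst.comp continuous_snd))).prodMk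
      (Cone.continuous_mk.comp (continuous_fst.prodMk (continuous_snd.comp continuous_snd)))
  obtain ⟨⟨x, s, t⟩, rfl⟩ : p ∈ range fun q : X × I × I => (Cone.mk q.1 q.2.1, Cone.mk q.1 q.2.2) :=
    closure_minimal (image_subset_iff.2 fun q hq => by
      obtain ⟨x, hx₁, hx₂⟩ := hray q hq
      exact ⟨(x, q.1.1.height, q.2.1.height), Prod.ext hx₁.symm hx₂.symm⟩)
      (isCompact_range hcont).isClosed hp
  exact congrArg (Cone.mk x) (Eq.trans (b := 1) h₁ h₂.symm)

theorem controlled_image_of_continuous {Y : Type v} [TopologicalSpace Y] [CompactSpace Y]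
    [T2Space Y] {G : Cone X × I → Cone Y} (hG : Continuous G)
    (hG_height : ∀ q, (G q).height = q.1.height) {S : Set ((OpenCone X × I) × (OpenCone X × I))}
    (hS : (continuouslyControlled X).Controlled ((fun p => (p.1.1, p.2.1)) '' S))
    (hS_param : ∀ ε > 0, ∃ n, ∀ p ∈ S, n ≤ level p.1.1 → dist p.1.2 p.2.2 ≤ ε)
    {N : Set (OpenCone Y × OpenCone Y)}
    (hN : ∀ p ∈ N, ∃ q ∈ S, p.1.1 = G (q.1.1.1, q.1.2) ∧ p.2.1 = G (q.2.1.1, q.2.2)) :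
    (continuouslyControlled Y).Controlled N := by
  let T : Set ((Cone X × I) × (Cone X × I)) := (fun p => ((p.1.1.1, p.1.2), (p.2.1.1, p.2.2))) '' S
  intro p hp hp₁
  obtain ⟨⟨⟨c, s⟩, d, t⟩, hT, rfl⟩ : p ∈ Prod.map G G '' closure T :=
    closure_minimal (image_subset_iff.2 fun q hq => by
      obtain ⟨z, hz, hz₁, hz₂⟩ := hN q hq
      exact ⟨_, subset_closure ⟨z, hz, rfl⟩, Prod.ext hz₁.symm hz₂.symm⟩)
      (isClosed_closure.isCompact.image (hG.prodMap hG)).isClosed hp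
  have hheight : c.height = 1 ∨ d.height = 1 := by simpa only [Prod.map_apply, hG_height] using hp₁
  have hcd : c = d := by
    refine hS (c, d) ?_ hheight
    refine map_mem_closure (f := fun p : (Cone X × I) × Cone X × I => (p.1.1, p.2.1))
      (by fun_prop) hT ?_
    rintro _ ⟨q, hq, rfl⟩
    exact ⟨_, mem_image_of_mem _ hq, rfl⟩
  subst hcd
  suffices hst : s = t from hst ▸ rfl
  refine eq_of_forall_dist_le fun ε hε => ?_
  obtain ⟨n, hn⟩ := hS_param ε hε
  have hcont : Continuous fun p : (Cone X × I) × Cone X × I => p.1.1.height :=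
    Cone.continuous_height.comp (by fun_prop)
  have hmem : ((c, s), c, t) ∈ closure ((fun p => p.1.1.height) ⁻¹' Ioi (heightOfLevel n) ∩ T) :=
    (isOpen_Ioi.preimage hcont).inter_closure
      ⟨(heightOfLevel_lt_one n).trans_eq (hheight.elim Eq.symm Eq.symm), hT⟩
  refine closure_minimal (t := {p : (Cone X × I) × Cone X × I | dist p.1.2 p.2.2 ≤ ε}) ?_
    (isClosed_le (by fun_prop) continuous_const) hmem
  rintro _ ⟨hlevel, q, hq, rfl⟩
  exact hn q hq (le_of_not_ge fun h => (level_le_iff.1 h).not_gt hlevel)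

theorem exists_level_le_of_disjoint (hM : (continuouslyControlled X).Controlled M)
    {K L : Set X} (hK : IsClosed K) (hL : IsClosed L) (hKL : Disjoint K L) :
    ∃ n, ∀ p ∈ M, (∃ x ∈ K, ∃ t, p.1.1 = Cone.mk x t) → (∃ y ∈ L, ∃ t, p.2.1 = Cone.mk y t) →
      level p.2 ≤ n := by
  let R : Set (Cone X × Cone X) := closure (lift M) ∩
    ((fun p => Cone.mk p.1 p.2) '' K ×ˢ univ) ×ˢ ((fun p => Cone.mk p.1 p.2) '' L ×ˢ univ)
  have hR : IsCompact R := (isClosed_closure.inter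
    ((Cone.isClosed_image_mk hK).prod (Cone.isClosed_image_mk hL))).isCompact
  obtain ⟨n, hn⟩ := exists_level_le_of_isCompact (hR.image continuous_snd) (by
    rintro _ ⟨⟨_, _⟩, ⟨hp, ⟨⟨x, s⟩, hx, rfl⟩, ⟨y, t⟩, hy, rfl⟩, rfl⟩ rfl
    have hxy : x = y := (Cone.eq_of_mk_eq_mk (hM _ hp (Or.inr rfl)).symm one_ne_zero).symm
    exact hKL.ne_of_mem hx.1 hy.1 hxy)
  refine ⟨n, fun p hp ⟨x, hx, s, hs⟩ ⟨y, hy, t, ht⟩ => hn _ ⟨(p.1.1, p.2.1), ⟨?_, ?_, ?_⟩, rfl⟩⟩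
  · exact subset_closure ⟨p, hp, rfl⟩
  · exact ⟨(x, s), ⟨hx, mem_univ _⟩, hs.symm⟩
  · exact ⟨(y, t), ⟨hy, mem_univ _⟩, ht.symm⟩

end continuouslyControlled

/-! ### The graph of the radial coordinate -/

namespace CoarseSpace

open CoarseStructure

variable {X : CoarseSpace.{u}} {f : X.carrier → ℝ≥0}

/-- The part of `X × [0, ∞)` on or below the graph of `f`. -/
def subgraph (X : CoarseSpace.{u}) (f : X.carrier → ℝ≥0) : Set X.prodRay.carrier :=
  {q | q.2 ≤ f q.1}

/-- The part of `X × [0, ∞)` on or above the graph of `f`. -/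
def epigraph (X : CoarseSpace.{u}) (f : X.carrier → ℝ≥0) : Set X.prodRay.carrier :=
  {q | f q.1 ≤ q.2}

/-- The projection to `X` of the part of `X × [0, ∞)` below the graph of `f`. -/
def subgraphProj (hf : IsCoarseMap X.str (ofBornology ℝ≥0) f) :
    X.prodRay.sub (X.subgraph f) ⟶ X :=
  ⟨fun q => q.1.1,
    isGeneralisedRay_ofMetric.isCoarseMap_fst_subgraph (isCoarseMap_ofBornology_iff.1 hf).1⟩

/-- The projection of the graph of `f` to `X`. -/
def graphProj (hf : IsCoarseMap X.str (ofBornology ℝ≥0) f) :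
    X.prodRay.sub (X.subgraph f ∩ X.epigraph f) ⟶ X :=
  X.prodRay.inclOfLE inter_subset_left ≫ subgraphProj hf

variable (f) in
theorem isCoarseMap_zeroSection :
    IsCoarseMap X.str (X.prodRay.sub (X.subgraph f)).str
      fun x => ⟨(x, 0), bot_le (a := f x)⟩ where
  controlled M hM := by
    refine sub_prod_controlled_iff.2 ⟨X.str.subset hM ?_, 0, ?_⟩
    · rintro _ ⟨_, ⟨p, hp, rfl⟩, rfl⟩
      exact hp
    · rintro _ ⟨_, ⟨p, -, rfl⟩, rfl⟩
      exact (dist_self _).le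
  proper _ hB := (sub_prod_bounded_iff.1 hB).1.mono fun _ hx => ⟨_, hx, rfl⟩

variable (f) in
/-- The inclusion of `X` as `X × {0}` in the part of `X × [0, ∞)` below the graph of `f`. -/
def zeroSection : X ⟶ X.prodRay.sub (X.subgraph f) :=
  ⟨_, isCoarseMap_zeroSection f⟩

theorem zeroSection_subgraphProj (hf : IsCoarseMap X.str (ofBornology ℝ≥0) f) :
    zeroSection f ≫ subgraphProj hf = 𝟙 X := rfl

theorem controlled_relImage_subgraph_inter_epigraph
    (hf : IsCoarseMap X.str (ofBornology ℝ≥0) f)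
    {m : Set (X.prodRay.carrier × X.prodRay.carrier)} (hm : X.prodRay.str.Controlled m) :
    (ofBornology ℝ≥0).Controlled ((fun q : X.prodRay.carrier => (q.2, f q.1)) ''
      (relImage m (X.subgraph f) ∩ relImage m (X.epigraph f))) := by
  obtain ⟨hm₁, C, hC⟩ := prod_controlled_iff.1 hm
  have hf_m := ofBornology_nnreal_controlled_iff.1 (hf.controlled _ hm₁)
  have hdist : ∀ p ∈ m, p.1.2 ≤ p.2.2 + C.toNNReal ∧ p.2.2 ≤ p.1.2 + C.toNNReal := by
    intro p hp
    have h := abs_le.1 ((NNReal.dist_eq _ _).ge.trans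
      ((hC _ (mem_image_of_mem _ hp)).trans (Real.le_coe_toNNReal C)))
    constructor <;> rw [← NNReal.coe_le_coe] <;> push_cast <;> linarith
  refine ofBornology_nnreal_controlled_iff.2 fun n => ?_
  obtain ⟨a, ha⟩ := hf_m n
  obtain ⟨b, hb⟩ := hf_m (n + C.toNNReal)
  refine ⟨max b (a + C.toNNReal), ?_⟩
  rintro _ ⟨q, ⟨⟨q₁, hq₁, h₁⟩, q₂, hq₂, h₂⟩, rfl⟩
  have hmem {p} (hp : p ∈ m) := mem_image_of_mem (Prod.map f f) (mem_image_of_mem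
    (fun p : X.prodRay.carrier × X.prodRay.carrier => (p.1.1, p.2.1)) hp)
  refine ⟨fun h => le_max_of_le_left ((hb _ (hmem h₂)).1 ?_), fun h => le_max_of_le_right ?_⟩
  · exact (le_trans hq₂ (hdist _ h₂).1).trans (by gcongr)
  · exact (hdist _ h₁).2.trans (by gcongr; exact le_trans hq₁ ((ha _ (hmem h₁)).2 h))

end CoarseSpace

namespace OpenCone

open CoarseStructure CoarseSpace

theorem coarselyExcisiveDecomposition_level (X : CompHaus.{u}) :
    (openCone X).prodRay.CoarselyExcisiveDecomposition
      ((openCone X).subgraph level) ((openCone X).epigraph level) := by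
  refine ⟨eq_univ_of_forall fun q => le_total q.2 (level q.1), fun m hm => ?_⟩
  have hW := controlled_relImage_subgraph_inter_epigraph (X := openCone X)
    continuouslyControlled.isCoarseMap_level hm
  set W := relImage m ((openCone X).subgraph level) ∩ relImage m ((openCone X).epigraph level)
  obtain ⟨b, hb⟩ := ofBornology_nnreal_controlled_iff.1 hW 0
  let vertical : Set ((openCone X).prodRay.carrier × (openCone X).prodRay.carrier) :=
    {p | p.1.1 = p.2.1 ∧ p.1.2 = 0 ∧ p.2.2 ≤ b}
  let radial : Set ((openCone X).prodRay.carrier × (openCone X).prodRay.carrier) :=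
    {p | p.2 ∈ W ∧ level p.1.1 = p.2.2 ∧ p.1.2 = p.2.2 ∧
      ∃ x, p.1.1.1 = Cone.mk x p.1.1.1.height ∧ p.2.1.1 = Cone.mk x p.2.1.1.height}
  have hvertical : (openCone X).prodRay.str.Controlled vertical := by
    refine prod_controlled_iff.2 ⟨(openCone X).str.subset (openCone X).str.diag ?_, b, ?_⟩
    · rintro _ ⟨p, hp, rfl⟩
      exact hp.1
    · rintro _ ⟨p, hp, rfl⟩
      have h₁ : (p.1.2 : ℝ) = 0 := congrArg _ hp.2.1
      have h₂ : (p.2.2 : ℝ) ≤ b := hp.2.2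
      exact (NNReal.dist_eq _ _).trans_le (by rwa [h₁, zero_sub, abs_neg, NNReal.abs_eq])
  have hradial : (openCone X).prodRay.str.Controlled radial := by
    refine prod_controlled_iff.2 ⟨continuouslyControlled.controlled_of_sameRay
      ((ofBornology ℝ≥0).subset hW ?_) ?_, 0, ?_⟩
    · rintro _ ⟨_, ⟨p, hp, rfl⟩, rfl⟩
      exact ⟨p.2, hp.1, Prod.ext hp.2.1.symm rfl⟩
    · rintro _ ⟨p, hp, rfl⟩
      exact hp.2.2.2
    · rintro _ ⟨p, hp, rfl⟩
      exact (dist_eq_zero.2 hp.2.2.1).le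
  refine ⟨_, (openCone X).prodRay.str.union hvertical hradial, fun ⟨c, r⟩ hq => ?_⟩
  by_cases hc : c.1.height = 0
  · have hlevel := level_eq_zero_iff.2 hc
    exact ⟨(c, 0), ⟨bot_le (a := level c), hlevel.le⟩,
      Or.inl ⟨rfl, rfl, (hb _ (mem_image_of_mem _ hq)).2 hlevel.le⟩⟩
  · obtain ⟨x, hx⟩ := Cone.exists_eq_mk_of_height_ne_zero hc
    let d : OpenCone X := ⟨Cone.mk x (heightOfLevel r), heightOfLevel_lt_one r⟩
    have hd : level d = r := level_eq_iff.2 rfl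
    exact ⟨(d, r), ⟨hd.ge, hd.le⟩, Or.inr ⟨hq, hd, rfl, x, rfl, hx⟩⟩

/-- The graph of the radial coordinate on `𝒪X`, as a subspace of `𝒪X × [0, ∞)`. It is a copy of
`𝒪X` with fewer controlled sets: the radial coordinate becomes a coarse map to the metric ray, as
is needed to turn homotopies between continuous maps into coarse homotopies. -/
abbrev levelGraph (X : CompHaus.{u}) : CoarseSpace.{u} :=
  (openCone X).prodRay.sub ((openCone X).subgraph level ∩ (openCone X).epigraph level)

theorem level_openConeMap {X Y : CompHaus.{u}} (f : X ⟶ Y) (c : (openCone X).carrier) :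
    level ((openConeMap f).toFun c) = level c :=
  level_eq_level_iff.2 (Cone.height_map _ _)

namespace levelGraph

variable {X Y Z : CompHaus.{u}}

theorem level_eq (q : (levelGraph X).carrier) : level q.1.1 = q.1.2 := le_antisymm q.2.2 q.2.1

theorem bounded_iff {B : Set (levelGraph X).carrier} :
    (levelGraph X).str.Bounded B ↔ Bornology.IsBounded ((fun q => q.1.2) '' B) := by
  refine (sub_prod_bounded_iff.trans (and_congr_right' ofMetric_bounded_iff)).trans
    (and_iff_right_of_imp fun hB => ?_)
  obtain ⟨n, hn⟩ := hB.bddAbove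
  refine continuouslyControlled.bounded_iff.2 ⟨n, ?_⟩
  rintro _ ⟨q, hq, rfl⟩
  exact (level_eq q).trans_le (hn (mem_image_of_mem _ hq))

theorem isCoarseMap_snd :
    IsCoarseMap (levelGraph X).str (ofMetric ℝ≥0) fun q => q.1.2 where
  controlled _ hM := (sub_prod_controlled_iff.1 hM).2
  proper _ hB := bounded_iff.2 ((ofMetric_bounded_iff.1 hB).subset (image_preimage_subset _ _))

/-- The map of graphs induced by a continuous map. -/
def map (f : X ⟶ Y) : levelGraph X ⟶ levelGraph Y where
  toFun q := ⟨((openConeMap f).toFun q.1.1, q.1.2),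
    ((level_openConeMap f q.1.1).trans (level_eq q)).ge,
    ((level_openConeMap f q.1.1).trans (level_eq q)).le⟩
  isCoarse :=
    { controlled := fun M hM => by
        obtain ⟨h, h'⟩ := sub_prod_controlled_iff.1 hM
        refine sub_prod_controlled_iff.2 ⟨(openCone Y).str.subset
          ((openConeMap f).isCoarse.controlled _ h) ?_, (ofMetric ℝ≥0).subset h' ?_⟩
        · rintro _ ⟨_, ⟨p, hp, rfl⟩, rfl⟩
          exact ⟨_, ⟨p, hp, rfl⟩, rfl⟩
        · rintro _ ⟨_, ⟨p, hp, rfl⟩, rfl⟩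
          exact ⟨p, hp, rfl⟩
      proper := fun B hB => bounded_iff.2 <| (bounded_iff.1 hB).subset <| by
        rintro _ ⟨q, hq, rfl⟩
        exact ⟨_, hq, rfl⟩ }

theorem map_comp (f : X ⟶ Y) (g : Y ⟶ Z) : map (f ≫ g) = map f ≫ map g :=
  CoarseSpace.Hom.ext <| funext fun q => Subtype.ext <| Prod.ext
    (congrArg (fun φ : openCone X ⟶ openCone Z => φ.toFun q.1.1) (openConeFunctor.map_comp f g)) rfl

theorem map_id : map (𝟙 X) = 𝟙 (levelGraph X) :=
  CoarseSpace.Hom.ext <| funext fun q => Subtype.ext <| Prod.ext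
    (congrArg (fun φ : openCone X ⟶ openCone X => φ.toFun q.1.1) (openConeFunctor.map_id X)) rfl

/-- The projection of the graph to the open cone. -/
noncomputable def proj (X : CompHaus.{u}) : levelGraph X ⟶ openCone X :=
  graphProj continuouslyControlled.isCoarseMap_level

theorem map_proj (f : X ⟶ Y) : map f ≫ proj Y = proj X ≫ openConeMap f := rfl

end levelGraph

end OpenCone

/-! ### Homotopies of continuous maps and coarse homotopies -/

theorem Cone.continuous_map_family {X Y : Type u} [TopologicalSpace X] [TopologicalSpace Y]
    (G : C(I × X, Y)) : Continuous fun p : Cone X × I => Cone.map (G.curry p.2) p.1 := by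
  have hq : IsQuotientMap (Quot.mk (ConeRel X)) := isQuotientMap_quot_mk
  refine hq.continuous_lift_prod_left (g := fun p : Cone X × I => Cone.map (G.curry p.2) p.1) ?_
  rw [← Homeomorph.sumProdDistrib.symm.comp_continuous_iff']
  refine continuous_sum_dom.2 ⟨continuous_const (y := Cone.apex Y), ?_⟩
  have hG : Continuous fun p : (X × I) × I => (G (p.2, p.1.1), p.1.2) := by fun_prop
  exact Cone.continuous_mk.comp hG

theorem abs_div_sub_div_le {a b c d : ℝ} (hb : 0 < b) (hd : 0 < d) (hcd : |c| ≤ d) :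
    |a / b - c / d| ≤ (|a - c| + |b - d|) / b := by
  have h : a / b - c / d = ((a - c) + c / d * (d - b)) / b := by
    field_simp
    ring
  have hcd' : |c / d| ≤ 1 := by rwa [abs_div, abs_of_pos hd, div_le_one hd]
  rw [h, abs_div, abs_of_pos hb]
  gcongr
  calc |(a - c) + c / d * (d - b)| ≤ |a - c| + |c / d * (d - b)| := abs_add_le _ _
    _ = |a - c| + |c / d| * |b - d| := by rw [abs_mul, abs_sub_comm d b]
    _ ≤ |a - c| + |b - d| := by gcongr; exact mul_le_of_le_one_left (abs_nonneg _) hcd'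

namespace OpenCone.levelGraph

open CoarseStructure CoarseSpace

variable {X Y : CompHaus.{u}}

/-- The parameter `u / (r + 1)` in the unit interval of a point `u ≤ r + 1` of the ray. -/
noncomputable def param (u r : ℝ≥0) : I := projIcc 0 1 zero_le_one ((u : ℝ) / (r + 1))

theorem param_zero (r : ℝ≥0) : param 0 r = 0 := by
  simp [param]

theorem param_self (r : ℝ≥0) : param (r + 1) r = 1 := by
  have h : ((r + 1 : ℝ≥0) : ℝ) / (r + 1) = 1 := by
    push_cast
    exact div_self (by positivity)
  rw [param, h, projIcc_right]
  rfl

theorem dist_param_le {u u' r r' : ℝ≥0} (hu' : u' ≤ r' + 1) :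
    dist (param u r) (param u' r') ≤ (dist u u' + dist r r') / ((r : ℝ) + 1) := by
  refine (abs_projIcc_sub_projIcc zero_le_one).trans ?_
  have h : |(u' : ℝ)| ≤ r' + 1 := by rw [NNReal.abs_eq]; exact_mod_cast hu'
  simpa only [add_sub_add_right_eq_sub, NNReal.dist_eq] using
    abs_div_sub_div_le (a := u) (by positivity : (0 : ℝ) < r + 1) (by positivity) h

/-- The map to the graph over `Y`, from the cylinder on the graph over `X`, that a homotopy
induces. -/
noncomputable def cylinderMapFun (G : C(I × X, Y))
    (q : ((levelGraph X).cylinder (ofMetric ℝ≥0) fun q => q.1.2).carrier) :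
    (levelGraph Y).carrier :=
  let c : OpenCone Y := ⟨Cone.map (G.curry (param q.1.2 q.1.1.1.2)) q.1.1.1.1.1, by
    rw [Cone.height_map]; exact q.1.1.1.1.2⟩
  have hc : level c = q.1.1.1.2 :=
    (level_eq_level_iff.2 (Cone.height_map _ _)).trans (level_eq q.1.1)
  ⟨(c, q.1.1.1.2), hc.ge, hc.le⟩

theorem isCoarseMap_cylinderMapFun (G : C(I × X, Y)) :
    IsCoarseMap ((levelGraph X).cylinder (ofMetric ℝ≥0) fun q => q.1.2).str (levelGraph Y).str
      (cylinderMapFun G) where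
  controlled M hM := by
    obtain ⟨hM, D, hD⟩ := sub_prod_controlled_iff.1 hM
    obtain ⟨hM, C, hC⟩ := sub_prod_controlled_iff.1 hM
    let S : Set ((OpenCone X × I) × (OpenCone X × I)) := (fun p =>
      ((p.1.1.1.1.1, param p.1.1.2 p.1.1.1.1.2), (p.2.1.1.1.1, param p.2.1.2 p.2.1.1.1.2))) '' M
    refine sub_prod_controlled_iff.2 ⟨continuouslyControlled.controlled_image_of_continuous (S := S)
      (Cone.continuous_map_family G) (fun q => Cone.height_map _ _) ?_ (fun ε hε => ?_) ?_, C, ?_⟩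
    · refine (openCone X).str.subset hM ?_
      rintro _ ⟨_, ⟨p, hp, rfl⟩, rfl⟩
      exact ⟨_, ⟨p, hp, rfl⟩, rfl⟩
    · refine ⟨((D + C) / ε).toNNReal, ?_⟩
      rintro _ ⟨p, hp, rfl⟩ hn
      have hr : (D + C) / ε ≤ p.1.1.1.1.2 + 1 := by
        rw [← level_eq]
        exact (Real.le_coe_toNNReal _).trans ((NNReal.coe_le_coe.2 hn).trans (by simp))
      refine (dist_param_le p.2.2).trans ((div_le_iff₀ (by positivity)).2 ?_)
      exact (add_le_add (hD _ ⟨p, hp, rfl⟩) (hC _ ⟨_, ⟨p, hp, rfl⟩, rfl⟩)).trans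
        ((div_le_iff₀' hε).1 hr)
    · rintro _ ⟨_, ⟨p, hp, rfl⟩, rfl⟩
      exact ⟨_, mem_image_of_mem _ hp, rfl, rfl⟩
    · rintro _ ⟨_, ⟨p, hp, rfl⟩, rfl⟩
      exact hC _ ⟨_, ⟨p, hp, rfl⟩, rfl⟩
  proper B hB := by
    refine ((isGeneralisedRay_ofMetric.isCoarseMap_fst_cylinder isCoarseMap_snd).proper
      {q | q.1.2 ∈ (fun q => q.1.2) '' B} ?_).mono fun q hq => ⟨_, hq, rfl⟩
    refine bounded_iff.2 ((bounded_iff.1 hB).subset ?_)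
    rintro _ ⟨q, hq, rfl⟩
    exact hq

theorem elementaryHomotopic_map {f₀ f₁ : X ⟶ Y}
    (F : ContinuousMap.Homotopy f₀.hom.hom f₁.hom.hom) :
    ElementaryHomotopic (map f₀) (map f₁) := by
  refine ⟨ofMetric ℝ≥0, fun q => q.1.2, isGeneralisedRay_ofMetric, isCoarseMap_snd,
    ⟨_, isCoarseMap_cylinderMapFun F.toContinuousMap⟩, fun q => ?_, fun q => ?_⟩ <;>
    refine Subtype.ext (Prod.ext (Subtype.ext ?_) rfl)
  · change Cone.map _ _ = Cone.map (F.curry (param 0 q.1.2)) _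
    rw [param_zero, F.curry_zero]
  · change Cone.map _ _ = Cone.map (F.curry (param (q.1.2 + 1) q.1.2)) _
    rw [param_self, F.curry_one]

theorem isCoarseHomotopyEquiv_map (e : ContinuousMap.HomotopyEquiv X Y) :
    IsCoarseHomotopyEquiv (map (CompHausLike.ofHom _ e.toFun : X ⟶ Y)) := by
  refine ⟨map (CompHausLike.ofHom _ e.invFun : Y ⟶ X), ?_, ?_⟩ <;> rw [← map_comp, ← map_id]
  · exact .rel _ _ (elementaryHomotopic_map e.left_inv.some)
  · exact .rel _ _ (elementaryHomotopic_map e.right_inv.some)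

end OpenCone.levelGraph

/-! ### Homotopy invariance -/

section HomotopyInvariance

variable {C : Type w} [Category.{v} C] {H : CompHaus.{u} ⥤ C} {X Y : CompHaus.{u}}

theorem map_eq_of_homotopic_of_epi
    (hH : ∀ {X Y : CompHaus.{u}} (e : ContinuousMap.HomotopyEquiv X Y),
      Epi (H.map (CompHausLike.ofHom _ e.toFun : X ⟶ Y)))
    {f₀ f₁ : X ⟶ Y} (h : ContinuousMap.Homotopic f₀.hom.hom f₁.hom.hom) :
    H.map f₀ = H.map f₁ := by
  obtain ⟨F⟩ := h
  let i (t : I) : X ⟶ CompHaus.of (I × X) := CompHausLike.ofHom _ ⟨fun x => (t, x), by fun_prop⟩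
  let π : CompHaus.of (I × X) ⟶ X := CompHausLike.ofHom _ ⟨Prod.snd, continuous_snd⟩
  let Φ : CompHaus.of (I × X) ⟶ Y := CompHausLike.ofHom _ F.toContinuousMap
  let e : ContinuousMap.HomotopyEquiv X (CompHaus.of (I × X)) :=
    { toFun := (i 0).hom.hom
      invFun := π.hom.hom
      left_inv := .refl _
      right_inv := ⟨⟨⟨fun p => (p.1 * p.2.1, p.2.2), by fun_prop⟩,
        fun x => Prod.ext (zero_mul _) rfl, fun x => Prod.ext (one_mul _) rfl⟩⟩ }
  have hi : Epi (H.map (i 0)) := hH e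
  have hiπ (t : I) : H.map (i t) ≫ H.map π = 𝟙 (H.obj X) := by
    rw [← H.map_comp, show i t ≫ π = 𝟙 X from rfl, H.map_id]
  -- `H.map (i 0)` is a split monomorphism as well as an epimorphism, hence inverse to `H.map π`.
  have hπi : H.map π ≫ H.map (i 0) = 𝟙 _ := by
    rw [← cancel_epi (H.map (i 0)), ← Category.assoc, hiπ, Category.id_comp, Category.comp_id]
  have hi01 : H.map (i 1) = H.map (i 0) := by
    rw [← Category.comp_id (H.map (i 1)), ← hπi, ← Category.assoc, hiπ,
      Category.id_comp]
  have h₀ : f₀ = i 0 ≫ Φ := by ext x; exact (F.apply_zero x).symm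
  have h₁ : f₁ = i 1 ≫ Φ := by ext x; exact (F.apply_one x).symm
  rw [h₀, h₁, H.map_comp, H.map_comp, hi01]

theorem isIso_map_of_homotopyEquiv_of_epi
    (hH : ∀ {X Y : CompHaus.{u}} (e : ContinuousMap.HomotopyEquiv X Y),
      Epi (H.map (CompHausLike.ofHom _ e.toFun : X ⟶ Y)))
    (e : ContinuousMap.HomotopyEquiv X Y) :
    IsIso (H.map (CompHausLike.ofHom _ e.toFun : X ⟶ Y)) := by
  let g : Y ⟶ X := CompHausLike.ofHom _ e.invFun
  refine ⟨H.map g, ?_, ?_⟩ <;> rw [← H.map_comp, ← H.map_id]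
  · exact map_eq_of_homotopic_of_epi hH e.left_inv
  · exact map_eq_of_homotopic_of_epi hH e.right_inv

end HomotopyInvariance

namespace IsCoarselyExcisive

open CoarseStructure CoarseSpace OpenCone TopSpectrum

variable {E : CoarseSpace.{u} ⥤ TopSpectrum.{v}}

theorem epi_map_graphProj (hE : IsCoarselyExcisive E) {X : CoarseSpace.{u}}
    {f : X.carrier → ℝ≥0} (hf : IsCoarseMap X.str (ofBornology ℝ≥0) f)
    (hexc : X.prodRay.CoarselyExcisiveDecomposition (X.subgraph f) (X.epigraph f)) (k : ℤ) :
    Epi ((E ⋙ stablePiFunctor k).map (graphProj hf)) := by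
  have hincl : Epi ((E ⋙ stablePiFunctor k).map (X.prodRay.inclOfLE inter_subset_left)) :=
    (epi_iff_surjective _).2 ((hE.excision _ _ _ hexc).mapPi_surjective
      (hE.flasque _ (flasque_prodRay X)) k)
  have hproj : IsSplitEpi (subgraphProj hf) := ⟨⟨⟨zeroSection f, zeroSection_subgraphProj hf⟩⟩⟩
  rw [graphProj, Functor.map_comp]
  infer_instance

theorem epi_map_openConeMap (hE : IsCoarselyExcisive E) {X Y : CompHaus.{u}}
    (e : ContinuousMap.HomotopyEquiv X Y) (k : ℤ) :
    Epi ((E ⋙ stablePiFunctor k).map (openConeMap (CompHausLike.ofHom _ e.toFun : X ⟶ Y))) := by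
  set H := E ⋙ stablePiFunctor k
  let f : X ⟶ Y := CompHausLike.ofHom _ e.toFun
  have hmap : Epi (H.map (levelGraph.map f)) := (epi_iff_surjective _).2
    (hE.homotopy _ _ _ (levelGraph.isCoarseHomotopyEquiv_map e) k).surjective
  have hproj : Epi (H.map (levelGraph.proj Y)) :=
    hE.epi_map_graphProj _ (coarselyExcisiveDecomposition_level Y) k
  have hcomp : Epi (H.map (levelGraph.proj X) ≫ H.map (openConeMap f)) := by
    rw [← H.map_comp, ← levelGraph.map_proj, H.map_comp]
    infer_instance
  exact epi_of_epi (H.map (levelGraph.proj X)) _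

theorem isWeakEquiv_openConeMap (hE : IsCoarselyExcisive E) {X Y : CompHaus.{u}}
    (e : ContinuousMap.HomotopyEquiv X Y) :
    Hom.IsWeakEquiv (E.map (openConeMap (CompHausLike.ofHom _ e.toFun : X ⟶ Y))) := fun k =>
  (isIso_iff_bijective _).1 <| isIso_map_of_homotopyEquiv_of_epi
    (H := openConeFunctor ⋙ E ⋙ stablePiFunctor k) (hE.epi_map_openConeMap · k) e

end IsCoarselyExcisive

/-! ### Excision -/

theorem CoarseStructure.Bounded.controlled_singleton_prod {X : Type u} {s : CoarseStructure X}
    {B : Set X} (hB : s.Bounded B) (x : X) : s.Controlled ({x} ×ˢ B) := by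
  rcases hB with rfl | ⟨y, hy⟩
  · rw [prod_empty]
    exact s.controlled_empty
  · obtain ⟨M, hM, hxy⟩ := s.connected x y
    refine s.subset (s.comp hM (s.symm hy)) ?_
    rintro ⟨_, z⟩ ⟨rfl, hz⟩
    exact ⟨y, hxy, hz, rfl⟩

theorem CoarseSpace.coarselyExcisiveDecomposition_of_bounded {X : CoarseSpace.{u}}
    {A B : Set X.carrier} (hAB : A ∪ B = univ) (hne : (A ∩ B).Nonempty)
    (h : ∀ m, X.str.Controlled m → X.str.Bounded (relImage m Aᶜ ∩ Bᶜ)) :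
    X.CoarselyExcisiveDecomposition A B := by
  refine ⟨hAB, fun m hm => ?_⟩
  obtain ⟨x, hx⟩ := hne
  let P : Set X.carrier := relImage m Aᶜ ∩ Bᶜ
  let Q : Set X.carrier := relImage m (relImage (Prod.swap ⁻¹' m) Aᶜ ∩ Bᶜ)
  have hP : X.str.Controlled ({x} ×ˢ P) := (h m hm).controlled_singleton_prod x
  have hQ : X.str.Controlled ({x} ×ˢ Q) :=
    ((h _ (X.str.symm hm)).relImage hm).controlled_singleton_prod x
  refine ⟨_, X.str.union (X.str.union X.str.diag hm) (X.str.union hP hQ), ?_⟩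
  rintro c ⟨⟨a, ha, hac⟩, b, hb, hbc⟩
  by_cases hcA : c ∈ A
  · by_cases hcB : c ∈ B
    · exact ⟨c, ⟨hcA, hcB⟩, .inl (.inl rfl)⟩
    by_cases hbA : b ∈ A
    · exact ⟨b, ⟨hbA, hb⟩, .inl (.inr hbc)⟩
    · exact ⟨x, hx, .inr (.inl ⟨rfl, ⟨b, hbA, hbc⟩, hcB⟩)⟩
  · by_cases haB : a ∈ B
    · exact ⟨a, ⟨ha, haB⟩, .inl (.inr hac)⟩
    · exact ⟨x, hx, .inr (.inr ⟨rfl, a, ⟨⟨c, hcA, hac⟩, haB⟩, hac⟩)⟩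

section OpenConeOver

open OpenCone

variable (X : CompHaus.{u}) {U V : Set X}

theorem openConeOver_inter :
    openConeOver X (U ∩ V) = openConeOver X U ∩ openConeOver X V := by
  refine Subset.antisymm (subset_inter (openConeOver_mono X inter_subset_left)
    (openConeOver_mono X inter_subset_right)) fun c ⟨hU, hV⟩ => ?_
  refine or_iff_not_imp_left.2 fun hc => ?_
  obtain ⟨x, hx, t, ht⟩ := hU.resolve_left hc
  obtain ⟨y, hy, s, hs⟩ := hV.resolve_left hc
  have ht0 : t ≠ 0 := fun h => hc (by rw [ht, h]; rfl)
  obtain rfl : x = y := Cone.eq_of_mk_eq_mk (ht.symm.trans hs) ht0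
  exact ⟨x, ⟨hx, hy⟩, t, ht⟩

theorem openConeOver_union_eq_univ (hUV : U ∪ V = univ) :
    openConeOver X U ∪ openConeOver X V = univ := by
  refine eq_univ_of_forall fun c => ?_
  by_cases hc : c.1.height = 0
  · exact .inl (.inl hc)
  · obtain ⟨x, hx⟩ := Cone.exists_eq_mk_of_height_ne_zero hc
    exact (hUV.ge (mem_univ x)).imp (fun h => .inr ⟨x, h, _, hx⟩) fun h => .inr ⟨x, h, _, hx⟩

variable {X}

theorem exists_eq_mk_of_notMem_openConeOver {c : (openCone X).carrier}
    (hc : c ∉ openConeOver X U) : ∃ x ∈ Uᶜ, ∃ t, c.1 = Cone.mk x t := by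
  obtain ⟨x, hx⟩ := Cone.exists_eq_mk_of_height_ne_zero fun h => hc (.inl h)
  exact ⟨x, fun hxU => hc (.inr ⟨x, hxU, _, hx⟩), _, hx⟩

theorem coarselyExcisiveDecomposition_openConeOver (hU : IsOpen U) (hV : IsOpen V)
    (hUV : U ∪ V = univ) :
    (openCone X).CoarselyExcisiveDecomposition (openConeOver X U) (openConeOver X V) := by
  have hdisj : Disjoint Uᶜ Vᶜ := by
    rw [disjoint_compl_left_iff_subset, compl_subset_iff_union, union_comm, hUV]
  refine CoarseSpace.coarselyExcisiveDecomposition_of_bounded (openConeOver_union_eq_univ X hUV)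
    ⟨⟨Cone.apex X, zero_lt_one⟩, .inl rfl, .inl rfl⟩ fun m hm => ?_
  obtain ⟨n, hn⟩ := continuouslyControlled.exists_level_le_of_disjoint hm hU.isClosed_compl
    hV.isClosed_compl hdisj
  refine continuouslyControlled.bounded_iff.2 ⟨n, ?_⟩
  rintro d ⟨⟨c, hc, hcd⟩, hd⟩
  exact hn _ hcd (exists_eq_mk_of_notMem_openConeOver hc) (exists_eq_mk_of_notMem_openConeOver hd)

theorem IsCoarselyExcisive.isHomotopyPushout_openConeOver {E : CoarseSpace.{u} ⥤ TopSpectrum.{v}}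
    (hE : IsCoarselyExcisive E) (hU : IsOpen U) (hV : IsOpen V) (hUV : U ∪ V = univ) :
    TopSpectrum.IsHomotopyPushout
      (E.map ((openCone X).inclOfLE (openConeOver_mono X (inter_subset_left : U ∩ V ⊆ U))))
      (E.map ((openCone X).inclOfLE (openConeOver_mono X (inter_subset_right : U ∩ V ⊆ V))))
      (E.map ((openCone X).subIncl (openConeOver X U)))
      (E.map ((openCone X).subIncl (openConeOver X V))) := by
  generalize_proofs hU_subset hV_subset
  revert hU_subset hV_subset
  rw [openConeOver_inter]
  exact fun _ _ => hE.excision _ _ _ (coarselyExcisiveDecomposition_openConeOver hU hV hUV)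

end OpenConeOver

/-! ### Disjoint unions -/

theorem CoarseStructure.disjUnion_bounded_of_forall {ι : Type u} {X : ι → Type v}
    {s : ∀ i, CoarseStructure (X i)} {B : Set (Σ i, X i)}
    (hB : ∀ i, (s i).Bounded (Sigma.mk i ⁻¹' B)) : (disjUnion s).Bounded B := by
  refine bounded_iff_prod.2 ⟨fun _ => ∅, fun i => Sigma.mk i ⁻¹' B,
    fun i => (s i).controlled_empty, hB, ?_⟩
  rintro ⟨⟨i, x⟩, ⟨k, y⟩⟩ ⟨hx, hy⟩
  exact .inr (mem_iUnion₂.2 ⟨i, k, ⟨x, hx, rfl⟩, ⟨y, hy, rfl⟩⟩)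

theorem Cone.map_injective {X Y : Type u} [TopologicalSpace X] [TopologicalSpace Y]
    {f : C(X, Y)} (hf : Function.Injective f) : Function.Injective (Cone.map f) := by
  intro c d hcd
  have hheight : c.height = d.height := by rw [← height_map f, hcd, height_map]
  have eq_apex (e : Cone X) (he : e.height = 0) : e = apex X := by
    rcases eq_apex_or_eq_mk e with rfl | ⟨x, t, ht, rfl⟩
    exacts [rfl, absurd he ht]
  by_cases hc : c.height = 0
  · rw [eq_apex c hc, eq_apex d (hheight ▸ hc)]
  · obtain ⟨x, hx⟩ := exists_eq_mk_of_height_ne_zero hc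
    obtain ⟨y, hy⟩ := exists_eq_mk_of_height_ne_zero (hheight ▸ hc)
    rw [hx, hy] at hcd
    rw [hx, hy, hf (eq_of_mk_eq_mk hcd hc), hheight]

theorem continuouslyControlled.controlled_of_injective {X Y : CompHaus.{u}} {f : X ⟶ Y}
    (hf : Function.Injective f) {M : Set ((openCone X).carrier × (openCone X).carrier)}
    (hM : (openCone Y).str.Controlled
      (Prod.map (openConeMap f).toFun (openConeMap f).toFun '' M)) :
    (openCone X).str.Controlled M := by
  intro p hp hp₁
  refine Cone.map_injective hf (hM (Prod.map (Cone.map f.hom.hom) (Cone.map f.hom.hom) p) ?_ ?_)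
  · refine map_mem_closure
      ((Cone.continuous_map f.hom.hom).prodMap (Cone.continuous_map f.hom.hom)) hp ?_
    rintro _ ⟨q, hq, rfl⟩
    exact ⟨_, mem_image_of_mem _ hq, rfl⟩
  · simpa only [Prod.map_fst, Prod.map_snd, Cone.height_map] using hp₁

section DisjointUnion

open CoarseSpace OpenCone TopSpectrum

theorem OpenCone.level_eq_zero_of_isEmpty {X : Type u} [IsEmpty X] (c : OpenCone X) :
    level c = 0 :=
  level_eq_zero_iff.2 <| not_imp_comm.1 Cone.exists_eq_mk_of_height_ne_zero (by simp)

variable {ι : Type u} {K : ι → CompHaus.{u}} {L : CompHaus.{u}} {j : ∀ i, K i ⟶ L}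

theorem isOpen_range_of_isHomeomorph_sigma
    (hj : IsHomeomorph (fun p : Σ i, K i => (j p.1).hom.hom p.2)) (i : ι) :
    IsOpen (range (j i)) :=
  (hj.isOpenMap.comp isOpenMap_sigmaMk).isOpen_range

theorem finite_setOf_nonempty_of_isHomeomorph_sigma
    (hj : IsHomeomorph (fun p : Σ i, K i => (j p.1).hom.hom p.2)) :
    {i | Nonempty (K i)}.Finite := by
  obtain ⟨T, hT⟩ := isCompact_univ.elim_finite_subcover (fun i => range (j i))
    (isOpen_range_of_isHomeomorph_sigma hj) fun y _ => by
      obtain ⟨⟨i, x⟩, hx⟩ := hj.surjective y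
      exact mem_iUnion.2 ⟨i, x, hx⟩
  refine T.finite_toSet.subset ?_
  rintro i ⟨x⟩
  obtain ⟨k, hk, y, hy⟩ := mem_iUnion₂.1 (hT (mem_univ (j i x)))
  obtain rfl : k = i := congrArg Sigma.fst (hj.injective (a₁ := ⟨k, y⟩) (a₂ := ⟨i, x⟩) hy)
  exact hk

/-- The map `⋁ i, 𝒪 (K i) → 𝒪 L` induced by a family of maps `K i ⟶ L`. -/
def coneSum (j : ∀ i, K i ⟶ L) (x : Σ i, OpenCone (K i)) : OpenCone L :=
  (openConeMap (j x.1)).toFun x.2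

theorem level_coneSum (x : Σ i, OpenCone (K i)) : level (coneSum j x) = level x.2 :=
  level_openConeMap _ _

theorem exists_level_le_of_forall_bounded (hK : {i | Nonempty (K i)}.Finite)
    {B : ∀ i, Set (OpenCone (K i))} (hB : ∀ i, (continuouslyControlled (K i)).Bounded (B i)) :
    ∃ n, ∀ i, ∀ c ∈ B i, level c ≤ n := by
  choose n hn using fun i => continuouslyControlled.bounded_iff.1 (hB i)
  refine ⟨hK.toFinset.sup n, fun i c hc => ?_⟩
  rcases isEmpty_or_nonempty (K i) with hi | hi
  · exact (level_eq_zero_of_isEmpty c).trans_le bot_le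
  · exact (hn i c hc).trans (Finset.le_sup (f := n) (hK.mem_toFinset.2 hi))

theorem isCoarseMap_coneSum (hK : {i | Nonempty (K i)}.Finite) (j : ∀ i, K i ⟶ L) :
    IsCoarseMap (CoarseSpace.disjUnion fun i => openCone (K i)).str (openCone L).str
      (coneSum j) where
  controlled := by
    rintro M ⟨N, B, hN, hB, hM⟩
    obtain ⟨n, hn⟩ := exists_level_le_of_forall_bounded hK hB
    have hball : (openCone L).str.Bounded {c | level c ≤ n} :=
      continuouslyControlled.bounded_iff.2 ⟨n, fun _ hc => hc⟩
    refine (openCone L).str.subset ((openCone L).str.union ((openCone L).str.controlled_biUnion hK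
      fun i _ => (openConeMap (j i)).isCoarse.controlled _ (hN i)) (hball.prod hball)) ?_
    rintro _ ⟨p, hp, rfl⟩
    rcases hM hp with hp | hp
    · obtain ⟨i, q, hq, rfl⟩ := mem_iUnion.1 hp
      rcases isEmpty_or_nonempty (K i) with hi | hi
      · have hlevel (c : OpenCone (K i)) : level (coneSum j ⟨i, c⟩) ≤ n :=
          ((level_coneSum _).trans (level_eq_zero_of_isEmpty c)).trans_le bot_le
        exact .inr ⟨hlevel q.1, hlevel q.2⟩
      · exact .inl (mem_iUnion₂.2 ⟨i, hi, q, hq, rfl⟩)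
    · obtain ⟨x, y⟩ := p
      obtain ⟨i, k, ⟨c, hc, rfl⟩, d, hd, rfl⟩ := mem_iUnion₂.1 hp
      exact .inr ⟨(level_coneSum _).trans_le (hn i c hc), (level_coneSum _).trans_le (hn k d hd)⟩
  proper B hB := by
    obtain ⟨n, hn⟩ := continuouslyControlled.bounded_iff.1 hB
    refine CoarseStructure.disjUnion_bounded_of_forall fun i =>
      continuouslyControlled.bounded_iff.2 ⟨n, fun c hc => ?_⟩
    exact (level_coneSum ⟨i, c⟩).symm.trans_le (hn _ hc)

theorem coneSum_surjective [Nonempty ι]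
    (hj : Function.Surjective (fun p : Σ i, K i => (j p.1).hom.hom p.2)) :
    Function.Surjective (coneSum j) := by
  rintro ⟨c, hc⟩
  rcases Cone.eq_apex_or_eq_mk c with rfl | ⟨y, t, -, rfl⟩
  · exact ⟨⟨Classical.arbitrary ι, Cone.apex _, zero_lt_one⟩, rfl⟩
  · obtain ⟨⟨i, x⟩, rfl⟩ := hj y
    exact ⟨⟨i, Cone.mk x t, hc⟩, rfl⟩

theorem exists_level_le_of_fst_ne
    (hj : IsHomeomorph (fun p : Σ i, K i => (j p.1).hom.hom p.2))
    {M : Set ((Σ i, OpenCone (K i)) × (Σ i, OpenCone (K i)))}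
    (hM : (continuouslyControlled L).Controlled (Prod.map (coneSum j) (coneSum j) '' M)) :
    ∃ n, ∀ p ∈ M, p.1.1 ≠ p.2.1 → level p.2.2 ≤ n := by
  choose n hn using fun i => continuouslyControlled.exists_level_le_of_disjoint hM
    (isCompact_range (j i).hom.hom.continuous).isClosed
    (isOpen_range_of_isHomeomorph_sigma hj i).isClosed_compl disjoint_compl_right
  obtain ⟨m, hm⟩ := continuouslyControlled.exists_level_le hM 0
  have hK := finite_setOf_nonempty_of_isHomeomorph_sigma hj
  have mk_mem (x : Σ i, OpenCone (K i)) (hx : x.2.1.height ≠ 0) :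
      ∃ a, ∃ t, (coneSum j x).1 = Cone.mk (j x.1 a) t := by
    obtain ⟨a, ha⟩ := Cone.exists_eq_mk_of_height_ne_zero hx
    exact ⟨a, _, congrArg (Cone.map (j x.1).hom.hom) ha⟩
  refine ⟨max (hK.toFinset.sup n) m, fun ⟨x, y⟩ hxy hne => ?_⟩
  rw [← level_coneSum (j := j)]
  by_cases hx : x.2.1.height = 0
  · refine le_max_of_le_right (hm _ (mem_image_of_mem _ hxy) ?_)
    exact ((level_coneSum x).trans (level_eq_zero_iff.2 hx)).le
  by_cases hy : y.2.1.height = 0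
  · exact ((level_coneSum y).trans (level_eq_zero_iff.2 hy)).trans_le bot_le
  obtain ⟨a, s, ha⟩ := mk_mem x hx
  obtain ⟨b, t, hb⟩ := mk_mem y hy
  refine le_max_of_le_left ((hn x.1 _ (mem_image_of_mem _ hxy) ⟨_, ⟨a, rfl⟩, s, ha⟩
    ⟨_, ?_, t, hb⟩).trans (Finset.le_sup (f := n) (hK.mem_toFinset.2 ⟨a⟩)))
  rintro ⟨z, hz⟩
  have hxy : (⟨x.1, z⟩ : Σ i, K i) = ⟨y.1, b⟩ := hj.injective hz
  exact hne (congrArg Sigma.fst hxy :)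

theorem controlled_of_controlled_image_coneSum
    (hj : IsHomeomorph (fun p : Σ i, K i => (j p.1).hom.hom p.2))
    {M : Set ((Σ i, OpenCone (K i)) × (Σ i, OpenCone (K i)))}
    (hM : (openCone L).str.Controlled (Prod.map (coneSum j) (coneSum j) '' M)) :
    (CoarseSpace.disjUnion fun i => openCone (K i)).str.Controlled M := by
  obtain ⟨n, hn⟩ := exists_level_le_of_fst_ne hj hM
  obtain ⟨m, hm⟩ := exists_level_le_of_fst_ne (M := Prod.swap ⁻¹' M) hj <|
    (openCone L).str.subset ((openCone L).str.symm hM) <| by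
      rintro _ ⟨p, hp, rfl⟩
      exact ⟨p.swap, hp, rfl⟩
  refine ⟨fun i => {p | (⟨i, p.1⟩, ⟨i, p.2⟩) ∈ M}, fun i => {c | level c ≤ max n m},
    fun i => ?_, fun i => continuouslyControlled.bounded_iff.2 ⟨_, fun _ hc => hc⟩, ?_⟩
  · have hji : Function.Injective (j i) := hj.injective.comp (sigma_mk_injective (i := i))
    refine continuouslyControlled.controlled_of_injective hji ((openCone L).str.subset hM ?_)
    rintro _ ⟨p, hp, rfl⟩
    exact ⟨_, hp, rfl⟩
  · rintro ⟨⟨i, c⟩, ⟨k, d⟩⟩ hp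
    by_cases hik : i = k
    · subst hik
      exact .inl (mem_iUnion.2 ⟨i, (c, d), hp, rfl⟩)
    · exact .inr (mem_iUnion₂.2 ⟨i, k, ⟨c, le_max_of_le_right (hm (_, _) hp (Ne.symm hik)), rfl⟩,
        ⟨d, le_max_of_le_left (hn _ hp hik), rfl⟩⟩)

/-- The map `coneSum` as a coarse map, when `L` is the disjoint union of the `K i`. -/
def coneSumHom (hj : IsHomeomorph (fun p : Σ i, K i => (j p.1).hom.hom p.2)) :
    CoarseSpace.disjUnion (fun i => openCone (K i)) ⟶ openCone L :=
  ⟨coneSum j, isCoarseMap_coneSum (finite_setOf_nonempty_of_isHomeomorph_sigma hj) j⟩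

theorem isCoarseHomotopyEquiv_coneSumHom [Nonempty ι]
    (hj : IsHomeomorph (fun p : Σ i, K i => (j p.1).hom.hom p.2)) :
    IsCoarseHomotopyEquiv (coneSumHom hj) :=
  isCoarseHomotopyEquiv_of_surjective (coneSum_surjective hj.surjective)
    (fun _ => controlled_of_controlled_image_coneSum hj) isGeneralisedRay_ofBornology
    (continuouslyControlled.isCoarseMap_level.comp (coneSumHom hj).isCoarse)

namespace IsCoarselyExcisive

variable {E : CoarseSpace.{u} ⥤ TopSpectrum.{v}} (hE : IsCoarselyExcisive E)
include hE

theorem isWeakEquiv_wedgeDesc_of_nonempty [Nonempty ι]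
    (hj : IsHomeomorph (fun p : Σ i, K i => (j p.1).hom.hom p.2)) :
    Hom.IsWeakEquiv (wedgeDesc fun i => E.map (openConeMap (j i))) := by
  intro k
  have hfactor (i : ι) : E.map (openConeMap (j i)) =
      (E.map (disjIncl (fun i => openCone (K i)) i)).comp (E.map (coneSumHom hj)) :=
    E.map_comp (disjIncl (fun i => openCone (K i)) i) (coneSumHom hj)
  simp only [hfactor, ← wedgeDesc_comp, Hom.mapPi_comp]
  exact (hE.homotopy _ _ _ (isCoarseHomotopyEquiv_coneSumHom hj) k).comp (hE.disjoint _ _ k)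

theorem weaklyContractible_openCone_of_isEmpty (X : CompHaus.{u}) [IsEmpty X] :
    (E.obj (openCone X)).WeaklyContractible := by
  have : IsEmpty (Σ _ : ULift.{u} Bool, X) := ⟨fun x => isEmptyElim x.2⟩
  have hfold : IsHomeomorph (fun p : Σ _ : ULift.{u} Bool, X => (𝟙 X : X ⟶ X).hom.hom p.2) :=
    ⟨continuous_of_const isEmptyElim, .of_isEmpty _, isEmptyElim, isEmptyElim⟩
  refine weaklyContractible_of_isWeakEquiv_fold (ι := ULift.{u} Bool) ?_
  have hwedge := hE.isWeakEquiv_wedgeDesc_of_nonempty (j := fun _ => 𝟙 X) hfold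
  have hmap : E.map (openConeMap (𝟙 X)) = 𝟙 (E.obj (openCone X)) :=
    (openConeFunctor ⋙ E).map_id X
  simpa only [hmap] using hwedge

theorem isWeakEquiv_wedgeDesc (hj : IsHomeomorph (fun p : Σ i, K i => (j p.1).hom.hom p.2)) :
    Hom.IsWeakEquiv (wedgeDesc fun i => E.map (openConeMap (j i))) := by
  rcases isEmpty_or_nonempty ι with hι | hι
  · have : IsEmpty L := hj.surjective.isEmpty
    exact (weaklyContractible_wedge_of_isEmpty _).isWeakEquiv
      (hE.weaklyContractible_openCone_of_isEmpty L) _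
  · exact hE.isWeakEquiv_wedgeDesc_of_nonempty hj

end IsCoarselyExcisive

end DisjointUnion

theorem mainTheorem5_general (E : CoarseSpace.{u} ⥤ TopSpectrum.{v}) (hE : IsCoarselyExcisive E) :
    (∀ (X Y : CompHaus.{u}) (f : X ⟶ Y) (e : ContinuousMap.HomotopyEquiv X Y),
        e.toFun = f.hom.hom → TopSpectrum.Hom.IsWeakEquiv (E.map (openConeMap f))) ∧
    (∀ (X : CompHaus.{u}) (U V : Set X), IsOpen U → IsOpen V → U ∪ V = Set.univ →
        TopSpectrum.IsHomotopyPushout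
          (E.map ((openCone X).inclOfLE (openConeOver_mono X (Set.inter_subset_left : U ∩ V ⊆ U))))
          (E.map ((openCone X).inclOfLE (openConeOver_mono X (Set.inter_subset_right : U ∩ V ⊆ V))))
          (E.map ((openCone X).subIncl (openConeOver X U)))
          (E.map ((openCone X).subIncl (openConeOver X V)))) ∧
    (∀ (ι : Type u) (X : ι → CompHaus.{u}) (Y : CompHaus.{u}) (j : ∀ i, X i ⟶ Y),
        IsHomeomorph (fun p : Σ i, X i => (j p.1).hom.hom p.2) →
        TopSpectrum.Hom.IsWeakEquiv
          (TopSpectrum.wedgeDesc fun i => E.map (openConeMap (j i)))) := by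
  refine ⟨fun X Y f e he => ?_, fun X U V => hE.isHomotopyPushout_openConeOver,
    fun ι X Y j => hE.isWeakEquiv_wedgeDesc⟩
  obtain rfl : CompHausLike.ofHom _ e.toFun = f := by
    rw [he]
    rfl
  exact hE.isWeakEquiv_openConeMap e

theorem mainTheorem5 (E : CoarseSpace.{u} ⥤ TopSpectrum.{v}) (hE : IsCoarselyExcisive E) :
    (∀ (X Y : hasCWType.{u}.FullSubcategory) (f : X ⟶ Y)
        (e : ContinuousMap.HomotopyEquiv X.obj Y.obj), e.toFun = f.hom.hom.hom →
        TopSpectrum.Hom.IsWeakEquiv ((coneTheory E).map f)) ∧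
    (∀ (X : hasCWType.{u}.FullSubcategory) (U V : Set X.obj), IsOpen U → IsOpen V →
        U ∪ V = Set.univ →
        TopSpectrum.IsHomotopyPushout
          (E.map ((openCone X.obj).inclOfLE
            (openConeOver_mono X.obj (Set.inter_subset_left : U ∩ V ⊆ U))))
          (E.map ((openCone X.obj).inclOfLE
            (openConeOver_mono X.obj (Set.inter_subset_right : U ∩ V ⊆ V))))
          (E.map ((openCone X.obj).subIncl (openConeOver X.obj U)))
          (E.map ((openCone X.obj).subIncl (openConeOver X.obj V)))) ∧
    (∀ (ι : Type u) (X : ι → hasCWType.{u}.FullSubcategory) (Y : hasCWType.{u}.FullSubcategory)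
        (j : ∀ i, X i ⟶ Y),
        IsHomeomorph (fun p : Σ i, (X i).obj => (j p.1).hom.hom.hom p.2) →
        TopSpectrum.Hom.IsWeakEquiv
          (TopSpectrum.wedgeDesc fun i => (coneTheory E).map (j i))) := by
  obtain ⟨homotopy, excision, disjoint⟩ := mainTheorem5_general E hE
  exact ⟨fun X Y f => homotopy X.obj Y.obj f.hom, fun X => excision X.obj,
    fun ι X Y j => disjoint ι (fun i => (X i).obj) Y.obj fun i => (j i).hom⟩
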